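/- **Setting.** Let $N,m\ge 1$, and let $U$ (the manifold $M_{(N)}$) be an open set of $N$-periodic sequences $w=(w_n)_{n\in\mathbb Z}$, $w_n\in\mathbb C^m$. Consider $dw/dt=K[w]$ on $U$, where $K$ is a Frechet smooth local vector field: there is a finite $J\subset\mathbb Z$ such that $K_n[w]$ is a smooth function of $(w_{n+j})_{j\in J}$, $N$-periodic in $n$. Let $K'^{*}[w]$ be the operator $(K'^{*}\varphi)_n=\sum_{j\in J}\big(\partial K_{n-j}/\partial w_{n}\big)^{\top}\varphi_{n-j}$ (the derivative being taken in the position $j$ of the stencil of $K_{n-j}$) on sequences $\varphi:\mathbb Z\to\mathbb C^m$; on periodic sequences it is the conjugate of the Frechet derivative $K'$ for the form $\sum_n\sum_i\varphi_{n,i}h_{n,i}$. Asymptotic expansions are for $\lambda\to\infty$, $\lambda\in\mathbb C$, in Poincaré's sense, locally uniformly in $w$ (or in $t$); "for large $|\lambda|$" is likewise meant locally uniformly. **Assumptions.** The system is Lax type integrable: there are $r\times r$ matrices $l_n[w;\lambda]$ and $p_n[w;\lambda]$, $N$-periodic in $n$, $l_n$ smooth in $w\in U$, such that for all large $|\lambda|$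 one has $dl_n/dt=p_{n+1}l_n-l_np_n$ along $K$. With the monodromy matrix $S_0=l_{N-1}\cdots l_0$, the functional $\bar\gamma(\lambda)=\operatorname{tr}S_0(\lambda)$ has an expansion $\bar\gamma(\lambda)\simeq\sum_{j\ge0}\bar\gamma_j\lambda^{j_0-j}$ with $j_0\in\mathbb Z_{\ge 0}$ and smooth functionals $\bar\gamma_j$ on $U$. The gradient of $\bar\gamma(\lambda)$ is non-degenerate in its first component: for some $q$, all $w\in U$ and all $n$, $\partial\bar\gamma_j/\partial w_n^{(1)}=0$ for $j<q$, and $\partial\bar\gamma_q/\partial w_n^{(1)}\neq0$. **The form of the solutions.** Consider $$\Phi_n(t;\lambda)=a_n[w(t);\lambda]\,e^{\omega(t;\lambda)}\prod_{j=0}^{n}\sigma_j[w(t);\lambda],\qquad n\in\mathbb Z,\tag{1}$$ where $w(t)\in U$ solves $dw/dt=K[w]$ on an open interval, $a_n=(1,a_{(1),n},\dots,a_{(m-1),n})^\top$ and $\sigma_n$ are $N$-periodic in $n$, smooth in $w$ for large $|\lambda|$, and, with integers $\tilde a,\tilde\sigma$ and coefficients that are smooth functionals on $U$, $$a_{(k),n}\simeq\sum_{s\ge0}a_{(k),n}^{(s)}[w]\lambda^{-s+\tilde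 a},\qquad \sigma_n\simeq\sum_{s\ge0}\sigma_n^{(s)}[w]\lambda^{-s+\tilde\sigma},\qquad \sigma_n^{(0)}\ne0 \text{ on } U .$$ The dispersion function $\omega(t;\lambda)$ may depend on the trajectory $w(t)$ and is differentiable in $t$ for large $|\lambda|$. For $n<0$ the product is fixed by $P_{-1}=1$, $P_n=P_{n-1}\sigma_n$. The data $(a,\sigma)$ are said to give an *asymptotic solution* of the Lax equation $$d\varphi/dt+K'^{*}\varphi=0\tag{2}$$ if for every trajectory $w(t)$ in $U$ there is $\omega$ such that $\big(e^{\omega}\prod_{j=0}^n\sigma_j\big)^{-1}\big(d\Phi_n/dt+(K'^{*}\Phi)_n\big)=O(\lambda^{-k})$ for all $n\in\mathbb Z$ and all $k\ge0$, locally uniformly in $t$. **Proposition.** 1. There are data $(a,\sigma)$ as above and a covector field $\varphi(\lambda)\in T^*(M_{(N)})$, $N$-periodic in $n$ and smooth in $w$, that satisfies (2) on $U$ for large $|\lambda|$ ($d/dt$ being the derivative along $K$), such that for every trajectory $w(t)$ there is $\omega$ for which $\varphi_n[w(t);\lambda]=\Phi_n(t;\lambda)$ for all $n\in\mathbb Z$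 and large $|\lambda|$; with this $\omega$, (1) solves (2) asymptotically in the above sense. 2. For any data $(a,\sigma)$ that give an asymptotic solution of (2) (whether or not $\Phi_n$ itself is periodic in $n$), the functional $\gamma(\lambda)=\sum_{n\in\mathbb Z_N}\ln\big(\lambda^{-\tilde\sigma}\sigma_n[w;\lambda]\big)$ is a generating function of conservation laws: on every open $V\subseteq U$ on which continuous branches $b_n$ of $\ln\sigma_n^{(0)}$ are chosen, and with the branches of the logarithms in $\gamma$ that tend to $b_n$ as $\lambda\to\infty$, one has $\gamma(\lambda)\simeq\sum_{j\ge0}\gamma_j\lambda^{-j}$, where each $\gamma_j$ is a smooth functional on $V$ and is constant along the solutions of $dw/dt=K[w]$ in $V$. -/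

import Mathlib

open Filter Topology Asymptotics
open scoped ContDiff

/-- The `N`-periodic sequences `w = (w_n)` with values in `ℂ^m`; the periodic manifold `M_(N)` is
an open subset `U` of this space. -/
abbrev Config (N m : ℕ) : Type := ZMod N → Fin m → ℂ

/-- A local vector field: `K_n[w] = kernel n ((w_{n+j})_{j ∈ J})` with a finite set `J ⊆ ℤ` of
offsets, the dependence on `n` being `N`-periodic. -/
structure LocalSystem (N m : ℕ) where
  J : Finset ℤ
  kernel : ZMod N → (J → Fin m → ℂ) → Fin m → ℂ

namespace LocalSystem

variable {N m : ℕ}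

/-- The tuple `(w_{n+j})_{j ∈ J}` on which `K_n[w]` depends. -/
def stencil (K : LocalSystem N m) (w : Config N m) (n : ZMod N) : K.J → Fin m → ℂ :=
  fun j => w (n + ((j : ℤ) : ZMod N))

/-- The vector field `w ↦ K[w]`. -/
def field (K : LocalSystem N m) (w : Config N m) : Config N m :=
  fun n => K.kernel n (K.stencil w n)

/-- Frechet smoothness of `K` on `U`. -/
def SmoothOn (K : LocalSystem N m) (U : Set (Config N m)) : Prop :=
  ∀ w ∈ U, ∀ n, ContDiffAt ℂ ∞ (K.kernel n) (K.stencil w n)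

/-- The `(k, i)` entry of the matrix `∂K_n / ∂w_{n+j}` at `w`, where the occurrences of the
variables in different positions of the stencil are kept apart. -/
noncomputable def jac (K : LocalSystem N m) (w : Config N m) (n : ZMod N) (j : K.J)
    (k i : Fin m) : ℂ :=
  fderiv ℂ (K.kernel n) (K.stencil w n) (Pi.single j (Pi.single i 1)) k

/-- The operator `K'^*[w]`, conjugate to the Frechet derivative
`(K'[w] h)_n = ∑_j (∂K_n / ∂w_{n+j}) h_{n+j}` for the bilinear form `∑_n ∑_i φ_{n,i} h_{n,i}`.
It acts on sequences over `ℤ`, which need not be periodic. -/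
noncomputable def adjoint (K : LocalSystem N m) (w : Config N m) (φ : ℤ → Fin m → ℂ) :
    ℤ → Fin m → ℂ :=
  fun n i => ∑ j : K.J, ∑ k : Fin m,
    K.jac w ((n - (j : ℤ) : ℤ) : ZMod N) j k i * φ (n - (j : ℤ)) k

/-- `w` is a solution of `dw/dt = K[w]` on the open interval `I`, with values in `U`. -/
structure IsTrajectory [NeZero N] (K : LocalSystem N m) (U : Set (Config N m)) (I : Set ℝ)
    (w : ℝ → Config N m) : Prop where
  isOpen : IsOpen I
  ordConnected : I.OrdConnected
  mem : ∀ t ∈ I, w t ∈ U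
  hasDerivAt : ∀ t ∈ I, HasDerivAt w (K.field (w t)) t

/-- The functional `g` is constant along the solutions of `dw/dt = K[w]` in `U`. -/
def IsConservationLaw [NeZero N] (K : LocalSystem N m) (U : Set (Config N m)) (g : Config N m → ℂ) : Prop :=
  ∀ (I : Set ℝ) (w : ℝ → Config N m), K.IsTrajectory U I w →
    ∀ s ∈ I, ∀ t ∈ I, g (w s) = g (w t)

/-- The smooth covector field `φ(z) ∈ T^*(M_(N))`, defined locally uniformly for large `|z|`,
solves the Lax equation `dφ/dt + K'^* φ = 0`, where `d/dt` is the derivative along `K`. -/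
def IsLaxSolution [NeZero N] (K : LocalSystem N m) (U : Set (Config N m))
    (φ : Config N m → ℂ → Config N m) : Prop :=
  ∀ w₀ ∈ U, ∀ᶠ p in 𝓝 w₀ ×ˢ Bornology.cobounded ℂ,
    ContDiffAt ℂ ∞ (fun w => φ w p.2) p.1 ∧
    ∀ n : ℤ, fderiv ℂ (fun w => φ w p.2) p.1 (K.field p.1) (n : ZMod N)
      + K.adjoint p.1 (fun l : ℤ => φ p.1 p.2 (l : ZMod N)) n = 0

end LocalSystem

/-- The asymptotic expansion `f(w; z) ≃ ∑_{s ≥ 0} c_s(w) z^{d-s}` as `z → ∞`, in the sense of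
Poincare, locally uniformly in `w ∈ U` (for open `U`). -/
def HasExpansion {N m : ℕ} (U : Set (Config N m)) (f : Config N m → ℂ → ℂ) (d : ℤ)
    (c : ℕ → Config N m → ℂ) : Prop :=
  ∀ w₀ ∈ U, ∀ k : ℕ,
    (fun p : Config N m × ℂ =>
        f p.1 p.2 - ∑ s ∈ Finset.range k, c s p.1 * p.2 ^ (d - (s : ℤ)))
      =O[𝓝 w₀ ×ˢ Bornology.cobounded ℂ] (fun p => p.2 ^ (d - (k : ℤ)))

/-- A Lax type representation on `U` of the system `dw/dt = K[w]`: the linear problem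
`f_{n+1} = l_n[w; z] f_n` with `N`-periodic matrices, compatible along `K`, for all large `|z|`,
with an evolution `df_n/dt = p_n[w; z] f_n`, that is, `dl_n/dt = p_{n+1} l_n - l_n p_n`. -/
structure LaxRepresentation {N m : ℕ} [NeZero N] (K : LocalSystem N m) (U : Set (Config N m)) (r : ℕ) where
  l : ZMod N → Config N m → ℂ → Matrix (Fin r) (Fin r) ℂ
  p : ZMod N → Config N m → ℂ → Matrix (Fin r) (Fin r) ℂ
  smooth : ∀ᶠ z in Bornology.cobounded ℂ, ∀ n i j, ContDiffOn ℂ ∞ (fun w => l n w z i j) U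
  compat : ∀ᶠ z in Bornology.cobounded ℂ, ∀ w ∈ U, ∀ n i j,
    fderiv ℂ (fun v => l n v z i j) w (K.field w)
      = (p (n + 1) w z * l n w z - l n w z * p n w z) i j

namespace LaxRepresentation

variable {N m r : ℕ} [NeZero N] {K : LocalSystem N m} {U : Set (Config N m)}

/-- The fundamental solution `F_{n+k,n}`: `F_{n,n} = 1` and `F_{n+k+1,n} = l_{n+k} F_{n+k,n}`. -/
def fundamental (L : LaxRepresentation K U r) (w : Config N m) (z : ℂ) (n : ZMod N) :
    ℕ → Matrix (Fin r) (Fin r) ℂ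
  | 0 => 1
  | k + 1 => L.l (n + (k : ZMod N)) w z * L.fundamental w z n k

/-- The monodromy matrix `S_n = F_{n+N,n}`. -/
def monodromy (L : LaxRepresentation K U r) (n : ZMod N) (w : Config N m) (z : ℂ) :
    Matrix (Fin r) (Fin r) ℂ :=
  L.fundamental w z n N

end LaxRepresentation

/-- The component of the gradient of `g` at the site `n` in the first coordinate of `ℂ^m`. -/
noncomputable def gradFirst {N m : ℕ} [NeZero N] [NeZero m] (g : Config N m → ℂ) (w : Config N m)
    (n : ZMod N) : ℂ :=
  fderiv ℂ g w (Pi.single n (Pi.single 0 1))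

/-- `∏_{j=0}^{n} f_j` for every `n ∈ ℤ`: the sequence `P` with `P_{-1} = 1` and
`P_n = P_{n-1} f_n`. -/
noncomputable def siteProd (f : ℤ → ℂ) : ℤ → ℂ
  | Int.ofNat n => ∏ j ∈ Finset.range (n + 1), f (j : ℤ)
  | Int.negSucc n => (∏ j ∈ Finset.range n, f (-((j : ℤ) + 1)))⁻¹

/-- The `N`-periodic amplitudes `a_n[w; z] = (1, a_{(1),n}, …, a_{(m-1),n})` and factors
`σ_n[w; z]`, smooth in `w` locally uniformly for large `|z|`, with asymptotic expansions
`a_{(i),n} ≃ ∑_s a_{(i),n}^{(s)}[w] z^{-s+aOrder}` and `σ_n ≃ ∑_s σ_n^{(s)}[w] z^{-s+sOrder}` whose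
coefficients are smooth functionals; `sOrder` is the true order of `σ_n`. -/
structure LaxAnsatz {N m : ℕ} [NeZero N] [NeZero m] (U : Set (Config N m)) where
  a : ZMod N → Config N m → ℂ → Fin m → ℂ
  σ : ZMod N → Config N m → ℂ → ℂ
  aOrder : ℤ
  sOrder : ℤ
  aCoeff : ℕ → ZMod N → Fin m → Config N m → ℂ
  sCoeff : ℕ → ZMod N → Config N m → ℂ
  a_first : ∀ n w z, a n w z 0 = 1
  a_smooth : ∀ w₀ ∈ U, ∀ᶠ p in 𝓝 w₀ ×ˢ Bornology.cobounded ℂ,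
    ∀ n, ContDiffAt ℂ ∞ (fun w => a n w p.2) p.1
  s_smooth : ∀ w₀ ∈ U, ∀ᶠ p in 𝓝 w₀ ×ˢ Bornology.cobounded ℂ,
    ∀ n, ContDiffAt ℂ ∞ (fun w => σ n w p.2) p.1
  aCoeff_smooth : ∀ s n i, ContDiffOn ℂ ∞ (aCoeff s n i) U
  sCoeff_smooth : ∀ s n, ContDiffOn ℂ ∞ (sCoeff s n) U
  a_expansion : ∀ n i, i ≠ 0 → HasExpansion U (fun w z => a n w z i) aOrder
    (fun s => aCoeff s n i)
  s_expansion : ∀ n, HasExpansion U (σ n) sOrder (fun s => sCoeff s n)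
  sCoeff_zero_ne : ∀ n, ∀ w ∈ U, sCoeff 0 n w ≠ 0

namespace LaxAnsatz

variable {N m : ℕ} [NeZero N] [NeZero m] {U : Set (Config N m)}

/-- `φ_n(t; z) = a_n exp[om(t; z)] ∏_{j=0}^{n} σ_j` along the curve `w(t)`, for `n ∈ ℤ`. -/
noncomputable def covector (A : LaxAnsatz U) (w : ℝ → Config N m) (om : ℝ → ℂ → ℂ)
    (t : ℝ) (z : ℂ) : ℤ → Fin m → ℂ :=
  fun n i => A.a (n : ZMod N) (w t) z i * Complex.exp (om t z)
    * siteProd (fun j : ℤ => A.σ (j : ZMod N) (w t) z) n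

/-- Along the curve `w(t)`, `t ∈ I`, the expression `covector` solves `dφ/dt + K'^* φ = 0`
asymptotically as `z → ∞`: the residual, measured in units of
`exp[om(t; z)] ∏_{j=0}^{n} σ_j`, is `O(z^{-k})` for every `k`, locally uniformly in `t`. -/
def SolvesAsymptotically (A : LaxAnsatz U) (K : LocalSystem N m) (I : Set ℝ)
    (w : ℝ → Config N m) (om : ℝ → ℂ → ℂ) : Prop :=
  ∀ t₀ ∈ I,
    (∀ᶠ p in 𝓝 t₀ ×ˢ Bornology.cobounded ℂ, DifferentiableAt ℝ (fun t => om t p.2) p.1) ∧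
    ∀ (n : ℤ) (i : Fin m) (k : ℕ),
      (fun p : ℝ × ℂ =>
          (deriv (fun t => A.covector w om t p.2 n i) p.1
            + K.adjoint (w p.1) (A.covector w om p.1 p.2) n i)
          / (Complex.exp (om p.1 p.2) * siteProd (fun j : ℤ => A.σ (j : ZMod N) (w p.1) p.2) n))
        =O[𝓝 t₀ ×ˢ Bornology.cobounded ℂ] (fun p => p.2 ^ (-(k : ℤ)))

/-- The logarithm `ln (z^{-sOrder} σ_n[w; z])`, in the branch that tends to `b n w` as `z → ∞`;
here `b n` is a logarithm of the leading coefficient `σ_n^{(0)}`. -/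
noncomputable def logDensity (A : LaxAnsatz U) (b : ZMod N → Config N m → ℂ) (n : ZMod N)
    (w : Config N m) (z : ℂ) : ℂ :=
  b n w + Complex.log (z ^ (-A.sOrder) * A.σ n w z / A.sCoeff 0 n w)

theorem exp_logDensity (A : LaxAnsatz U) {b : ZMod N → Config N m → ℂ} {n : ZMod N}
    {w : Config N m} {z : ℂ} (hw : w ∈ U) (hb : Complex.exp (b n w) = A.sCoeff 0 n w)
    (hz : z ≠ 0) (hs : A.σ n w z ≠ 0) :
    Complex.exp (A.logDensity b n w z) = z ^ (-A.sOrder) * A.σ n w z := by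
  have h0 := A.sCoeff_zero_ne n w hw
  rw [logDensity, Complex.exp_add, hb,
    Complex.exp_log (div_ne_zero (mul_ne_zero (zpow_ne_zero _ hz) hs) h0)]
  field_simp

/-- The functional `γ(z) = ∑_{n ∈ ℤ_N} ln (z^{-sOrder} σ_n[w; z])`. -/
noncomputable def generator (A : LaxAnsatz U) (b : ZMod N → Config N m → ℂ)
    (w : Config N m) (z : ℂ) : ℂ :=
  ∑ n : ZMod N, A.logDensity b n w z

/-- `γ(z)` is a generating function of conservation laws: on every open `V ⊆ U` with continuous
branches `b n` of `ln σ_n^{(0)}` it has an expansion `γ(z) ≃ ∑_j γ_j z^{-j}` whose coefficients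
`γ_j` are smooth functionals, constant along the solutions of `dw/dt = K[w]`. -/
def GeneratesConservationLaws (A : LaxAnsatz U) (K : LocalSystem N m) : Prop :=
  ∀ (V : Set (Config N m)) (b : ZMod N → Config N m → ℂ), IsOpen V → V ⊆ U →
    (∀ n, ContinuousOn (b n) V) → (∀ n, ∀ w ∈ V, Complex.exp (b n w) = A.sCoeff 0 n w) →
    ∃ γ : ℕ → Config N m → ℂ,
      (∀ j, ContDiffOn ℂ ∞ (γ j) V) ∧
      HasExpansion V (A.generator b) 0 γ ∧
      ∀ j, K.IsConservationLaw V (γ j)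

end LaxAnsatz

/-! Existence. The compatibility condition makes the derivative of the monodromy matrix along `K` a
commutator, so its trace is conserved. Differentiating `dg(K) = 0` once more and using the symmetry
of the second derivative shows that the gradient of any conserved functional `g` solves the Lax
equation exactly; take for `φ` the gradient of `tr S_0`. By Cauchy's estimate the expansion of the
trace may be differentiated term by term, and non-degeneracy gives the first components `φ_{n,1}`
one exact order at all sites. Hence `a_n = φ_n / φ_{n,1}` and `σ_n = φ_{n,1} / φ_{n-1,1}` have
expansions, the product of the `σ_j` telescopes, and `e^ω` is `φ_{-1,1}`.

Conservation. Let `Q = ∏ σ_n` over one period. A shift by `N` multiplies `Φ` by `Q`, and `K'^*` has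
periodic coefficients, so `K'^*Φ` also acquires the factor `Q`. Subtracting the normalized residuals
of the first component at the sites `N - 1` and `-1` therefore cancels both `K'^*` and `ω` and
leaves `Q'/Q`, which is `dγ/dt`. It is thus `O(z^{-k})` for every `k` (`residual_sub_residual`,
`logDeriv_isBigO`). Integrating in `t`, locally uniformly in `z`, and comparing coefficients makes
every `γ_j` constant along trajectories. -/

/-- The expansion `f(w; z) ≃ ∑_s C_s(w) z^{-s}` along the filter `l`, with the coefficients
collected in a power series in `z⁻¹`. -/
def HasSeries {X : Type*} (l : Filter (X × ℂ)) (f : X × ℂ → ℂ) (C : X → PowerSeries ℂ) : Prop :=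
  ∀ k : ℕ, (fun p => f p - ∑ s ∈ Finset.range k, PowerSeries.coeff s (C p.1) * p.2⁻¹ ^ s)
    =O[l] (fun p => p.2⁻¹ ^ k)

/-! ### Algebra of asymptotic series in `z⁻¹` with coefficients depending on a parameter. -/

namespace HasSeries

variable {X : Type*} {l : Filter (X × ℂ)} {f g : X × ℂ → ℂ} {C D : X → PowerSeries ℂ}

theorem isBigO_one (h : HasSeries l f C) : f =O[l] (fun _ => (1 : ℂ)) := by
  simpa using h 0

theorem congr (h : HasSeries l f C) (hfg : f =ᶠ[l] g) : HasSeries l g C := fun k =>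
  (h k).congr' (hfg.mono fun p hp => by simp only [hp]) EventuallyEq.rfl

theorem congr_coeff (h : HasSeries l f C)
    (hCD : ∀ s, ∀ᶠ p in l, PowerSeries.coeff s (C p.1) = PowerSeries.coeff s (D p.1)) :
    HasSeries l f D := fun k => by
  have hk : ∀ᶠ p in l, ∀ s ∈ Finset.range k,
      PowerSeries.coeff s (C p.1) = PowerSeries.coeff s (D p.1) :=
    (Finset.eventually_all (Finset.range k)).2 fun s _ => hCD s
  refine (h k).congr' (hk.mono fun p hp => ?_) EventuallyEq.rfl
  simp only
  rw [Finset.sum_congr rfl fun s hs => by rw [hp s hs]]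

theorem const_coeff (c : X → ℂ) (hc : (fun p : X × ℂ => c p.1) =O[l] (fun _ => (1 : ℂ))) :
    HasSeries l (fun p => c p.1) (fun w => PowerSeries.C (c w)) := fun k => by
  rcases k with _ | k
  · simpa using hc
  · simp only [Finset.sum_range_succ', PowerSeries.coeff_C]
    simpa using isBigO_zero _ _

theorem one : HasSeries l (fun _ => (1 : ℂ)) (fun _ => 1) := by
  simpa using const_coeff (l := l) (fun _ => (1 : ℂ)) (isBigO_refl _ _)

theorem zero : HasSeries l (fun _ => (0 : ℂ)) (fun _ => 0) := fun k => by
  simpa using isBigO_zero _ _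

theorem add (hf : HasSeries l f C) (hg : HasSeries l g D) :
    HasSeries l (fun p => f p + g p) (fun w => C w + D w) := fun k => by
  refine ((hf k).add (hg k)).congr_left fun p => ?_
  simp only [map_add, add_mul, Finset.sum_add_distrib]
  ring

theorem sum {ι : Type*} (t : Finset ι) {f : ι → X × ℂ → ℂ} {C : ι → X → PowerSeries ℂ}
    (h : ∀ i ∈ t, HasSeries l (f i) (C i)) :
    HasSeries l (fun p => ∑ i ∈ t, f i p) (fun w => ∑ i ∈ t, C i w) := by
  classical
  induction t using Finset.induction_on with
  | empty => simpa using zero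
  | insert i t hi ih =>
    simp only [Finset.sum_insert hi]
    exact (h i (Finset.mem_insert_self _ _)).add
      (ih fun j hj => h j (Finset.mem_insert_of_mem hj))

theorem const_smul (a : ℂ) (hf : HasSeries l f C) :
    HasSeries l (fun p => a * f p) (fun w => a • C w) := fun k => by
  refine ((hf k).const_mul_left a).congr_left fun p => ?_
  simp only [PowerSeries.coeff_smul, smul_eq_mul, mul_sub, Finset.mul_sum, mul_assoc]

theorem sum_coeff_mul (A B : PowerSeries ℂ) (x : ℂ) (k : ℕ) :
    ∑ s ∈ Finset.range k, PowerSeries.coeff s (A * B) * x ^ s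
      = ∑ i ∈ Finset.range k, PowerSeries.coeff i A * (x ^ i *
        ∑ j ∈ Finset.range (k - i), PowerSeries.coeff j B * x ^ j) := by
  have := Finset.sum_range_diag_flip k fun i j =>
    PowerSeries.coeff i A * (x ^ i * (PowerSeries.coeff j B * x ^ j))
  simp only [Finset.mul_sum]
  rw [← this]
  refine Finset.sum_congr rfl fun s _ => ?_
  rw [PowerSeries.coeff_mul, Finset.Nat.sum_antidiagonal_eq_sum_range_succ
    (fun i j => PowerSeries.coeff i A * PowerSeries.coeff j B), Finset.sum_mul]
  refine Finset.sum_congr rfl fun i hi => ?_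
  have : x ^ s = x ^ i * x ^ (s - i) := by
    rw [← pow_add, Nat.add_sub_cancel' (Nat.lt_succ_iff.1 (Finset.mem_range.1 hi))]
  rw [this]
  ring

/-- In the `i`-th term `g` is cut at order `k - i`, so each error is `O(z^{-k})`. Here `C` need not
be the expansion of any function, which lets `inv` apply the bound to a formal inverse. -/
theorem isBigO_sum_coeff_mul (hg : HasSeries l g D)
    (hC : ∀ s, (fun p => PowerSeries.coeff s (C p.1)) =O[l] (fun _ => (1 : ℂ))) (k : ℕ) :
    (fun p : X × ℂ => (∑ i ∈ Finset.range k, PowerSeries.coeff i (C p.1) * p.2⁻¹ ^ i) * g p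
      - ∑ s ∈ Finset.range k, PowerSeries.coeff s (C p.1 * D p.1) * p.2⁻¹ ^ s)
      =O[l] (fun p => p.2⁻¹ ^ k) := by
  have h2 : (fun p : X × ℂ => ∑ i ∈ Finset.range k, PowerSeries.coeff i (C p.1) * (p.2⁻¹ ^ i *
      (g p - ∑ j ∈ Finset.range (k - i), PowerSeries.coeff j (D p.1) * p.2⁻¹ ^ j)))
      =O[l] (fun p => p.2⁻¹ ^ k) := by
    refine IsBigO.fun_sum fun i hi => ?_
    refine ((hC i).mul ((isBigO_refl (fun p : X × ℂ => p.2⁻¹ ^ i) l).mul (hg (k - i)))).congr_right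
      fun p => ?_
    rw [one_mul, ← pow_add, Nat.add_sub_cancel' (Finset.mem_range.1 hi).le]
  refine h2.congr_left fun p => ?_
  rw [sum_coeff_mul]
  simp only [mul_sub, Finset.sum_sub_distrib, Finset.sum_mul, mul_assoc]

theorem mul (hf : HasSeries l f C) (hg : HasSeries l g D)
    (hC : ∀ s, (fun p => PowerSeries.coeff s (C p.1)) =O[l] (fun _ => (1 : ℂ))) :
    HasSeries l (fun p => f p * g p) (fun w => C w * D w) := fun k => by
  refine ((((hf k).mul hg.isBigO_one).congr_right fun p => mul_one _).add
    (hg.isBigO_sum_coeff_mul hC k)).congr_left fun p => ?_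
  ring

theorem pow (hf : HasSeries l f C)
    (hC : ∀ s, (fun p => PowerSeries.coeff s (C p.1)) =O[l] (fun _ => (1 : ℂ))) (n : ℕ) :
    HasSeries l (fun p => f p ^ n) (fun w => C w ^ n) := by
  induction n with
  | zero => simpa using one
  | succ n ih =>
    simp only [pow_succ']
    exact hf.mul ih hC

/-- If `T` is the truncation of the formal inverse, then `T f - 1 = O(z^{-k})` because the formal
product is `1`, and `f⁻¹ - T = -f⁻¹ (T f - 1)`. Only boundedness of `f⁻¹` is needed. The case `k =
0` is separate, since an empty truncation of the series `1` is `0`. -/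
theorem inv (hf : HasSeries l f C) (h0 : ∀ᶠ p in l, PowerSeries.constantCoeff (C p.1) ≠ 0)
    (hD : ∀ s, (fun p => PowerSeries.coeff s (C p.1)⁻¹) =O[l] (fun _ => (1 : ℂ)))
    (hfi : (fun p => (f p)⁻¹) =O[l] (fun _ => (1 : ℂ))) (hf0 : ∀ᶠ p in l, f p ≠ 0) :
    HasSeries l (fun p => (f p)⁻¹) (fun w => (C w)⁻¹) := fun k => by
  rcases k with _ | k
  · simpa using hfi
  refine ((hfi.mul (hf.isBigO_sum_coeff_mul (C := fun w => (C w)⁻¹) hD (k + 1))).neg_left.congr'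
    ?_ (Eventually.of_forall fun p => one_mul _))
  filter_upwards [h0, hf0] with p hp hfp
  rw [PowerSeries.inv_mul_cancel _ hp, Finset.sum_range_succ']
  simp only [PowerSeries.coeff_one]
  simp
  field_simp
  ring

/-- Since `f = O(z⁻¹)`, the Taylor polynomial of the logarithm has a small enough error. As `C` has
no constant term, `C ^ n` reaches the coefficient `s` only for `n ≤ s`, so that coefficient is a
finite sum. Its term `n = 0` vanishes because division by zero gives `0`. -/
theorem log_one_add (hf : HasSeries l f C) (h0 : ∀ w, PowerSeries.constantCoeff (C w) = 0)
    (hC : ∀ s, (fun p => PowerSeries.coeff s (C p.1)) =O[l] (fun _ => (1 : ℂ)))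
    (hx : Tendsto (fun p : X × ℂ => p.2⁻¹) l (𝓝 0)) :
    HasSeries l (fun p => Complex.log (1 + f p)) (fun w => PowerSeries.mk fun s =>
      ∑ n ∈ Finset.range (s + 1), (-1) ^ (n + 1) / (n : ℂ) * PowerSeries.coeff s (C w ^ n)) := by
  intro k
  have hO : f =O[l] (fun p => p.2⁻¹) := by
    simpa [h0] using hf 1
  have hlog : (fun p => Complex.log (1 + f p) - Complex.logTaylor (k + 1) (f p))
      =O[l] (fun p => p.2⁻¹ ^ k) := by
    refine ((Complex.log_sub_logTaylor_isBigO k).comp_tendsto (hO.trans_tendsto hx)).trans ?_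
    refine ((hO.pow (k + 1)).trans ?_)
    refine (((isBigO_refl (fun p : X × ℂ => p.2⁻¹ ^ k) l).mul (hx.isBigO_one ℂ)).congr
      (fun p => (pow_succ _ _).symm) fun p => mul_one _)
  have hpoly := (sum (Finset.range (k + 1)) fun n _ =>
    (hf.pow hC n).const_smul ((-1) ^ (n + 1) / (n : ℂ))) k
  refine (hlog.add hpoly).congr_left fun p => ?_
  have hT : Complex.logTaylor (k + 1) (f p)
      = ∑ n ∈ Finset.range (k + 1), (-1) ^ (n + 1) / (n : ℂ) * f p ^ n :=
    Finset.sum_congr rfl fun n _ => by ring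
  rw [hT, sub_add_sub_cancel]
  congr 1
  refine Finset.sum_congr rfl fun s hs => ?_
  congr 1
  rw [PowerSeries.coeff_mk, map_sum]
  simp only [PowerSeries.coeff_smul, smul_eq_mul]
  symm
  refine Finset.sum_subset (Finset.range_mono (Nat.succ_le_succ (Finset.mem_range.1 hs).le)) ?_
  intro n _ hn
  have hX : (PowerSeries.X : PowerSeries ℂ) ^ n ∣ C p.1 ^ n :=
    pow_dvd_pow_of_dvd (PowerSeries.X_dvd_iff.2 (h0 _)) n
  rw [PowerSeries.X_pow_dvd_iff.1 hX s (by simpa using hn), mul_zero]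

end HasSeries

/-! ### Neighbourhoods of `z = ∞` and uniqueness of coefficients. -/

theorem tendsto_inv_snd_cobounded {X : Type*} (l : Filter X) :
    Tendsto (fun p : X × ℂ => p.2⁻¹) (l ×ˢ Bornology.cobounded ℂ) (𝓝 0) :=
  tendsto_inv₀_cobounded.comp tendsto_snd

theorem eventually_snd_ne_zero {X : Type*} (l : Filter X) :
    ∀ᶠ p : X × ℂ in l ×ˢ Bornology.cobounded ℂ, p.2 ≠ 0 :=
  tendsto_snd.eventually (Bornology.eventually_ne_cobounded 0)

/-- With `z` frozen the property holds on a whole neighbourhood of the first variable, as is needed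
to differentiate in it. -/
theorem eventually_prod_nhds {X Y : Type*} [TopologicalSpace X] {l : Filter Y} {x : X}
    {P : X × Y → Prop} (h : ∀ᶠ p in 𝓝 x ×ˢ l, P p) :
    ∀ᶠ p in 𝓝 x ×ˢ l, ∀ᶠ y in 𝓝 p.1, P (y, p.2) := by
  obtain ⟨A, hA, B, hB, hAB⟩ := eventually_prod_iff.1 h
  exact eventually_prod_iff.2 ⟨_, hA.eventually_nhds, B, hB,
    fun hx y hy => hx.mono fun x' hx' => hAB hx' hy⟩

theorem eq_zero_of_mul_inv_pow_isBigO {a : ℂ} {k : ℕ}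
    (h : (fun z : ℂ => a * z⁻¹ ^ k) =O[Bornology.cobounded ℂ] (fun z => z⁻¹ ^ (k + 1))) :
    a = 0 := by
  have h2 : (fun _ : ℂ => a) =O[Bornology.cobounded ℂ] (fun z : ℂ => z⁻¹) := by
    refine (h.mul (isBigO_refl (fun z : ℂ => z ^ k) _)).congr' ?_ ?_ <;>
    filter_upwards [Bornology.eventually_ne_cobounded (0 : ℂ)] with z hz
    · rw [mul_assoc, ← mul_pow, inv_mul_cancel₀ hz, one_pow, mul_one]
    · rw [pow_succ', mul_assoc, ← mul_pow, inv_mul_cancel₀ hz, one_pow, mul_one]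
  exact tendsto_nhds_unique tendsto_const_nhds (h2.trans_tendsto tendsto_inv₀_cobounded)

/-! ### Smoothness of the coefficients of formal products, powers and inverses. -/

section Smooth

variable {E : Type*} [NormedAddCommGroup E] [NormedSpace ℂ E] {U : Set E}
  {C D : E → PowerSeries ℂ}

theorem contDiffOn_coeff_mul (hC : ∀ s, ContDiffOn ℂ ∞ (fun w => PowerSeries.coeff s (C w)) U)
    (hD : ∀ s, ContDiffOn ℂ ∞ (fun w => PowerSeries.coeff s (D w)) U) (s : ℕ) :
    ContDiffOn ℂ ∞ (fun w => PowerSeries.coeff s (C w * D w)) U := by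
  simp only [PowerSeries.coeff_mul]
  exact ContDiffOn.sum fun i _ => (hC _).mul (hD _)

theorem contDiffOn_coeff_pow (hC : ∀ s, ContDiffOn ℂ ∞ (fun w => PowerSeries.coeff s (C w)) U)
    (n s : ℕ) : ContDiffOn ℂ ∞ (fun w => PowerSeries.coeff s (C w ^ n)) U := by
  induction n generalizing s with
  | zero => simpa using contDiffOn_const
  | succ n ih =>
    simp only [pow_succ']
    exact contDiffOn_coeff_mul hC ih s

theorem contDiffOn_coeff_inv (hC : ∀ s, ContDiffOn ℂ ∞ (fun w => PowerSeries.coeff s (C w)) U)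
    (h0 : ∀ w ∈ U, PowerSeries.constantCoeff (C w) ≠ 0) (s : ℕ) :
    ContDiffOn ℂ ∞ (fun w => PowerSeries.coeff s (C w)⁻¹) U := by
  have hc : ContDiffOn ℂ ∞ (fun w => (PowerSeries.constantCoeff (C w))⁻¹) U :=
    (by simpa using hC 0 : ContDiffOn ℂ ∞ (fun w => PowerSeries.constantCoeff (C w)) U).inv h0
  induction s using Nat.strong_induction_on with
  | _ s ih =>
    simp only [PowerSeries.coeff_inv s]
    split_ifs with hs
    · exact hc
    · refine hc.neg.mul (ContDiffOn.sum fun i _ => ?_)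
      by_cases hi : i.2 < s
      · simpa only [if_pos hi] using (hC _).mul (ih _ hi)
      · simpa only [if_neg hi] using contDiffOn_const

end Smooth

/-! ### Quotients and logarithms of expansions. -/

namespace HasExpansion

variable {N m : ℕ} {U : Set (Config N m)} {f g : Config N m → ℂ → ℂ} {d e : ℤ}
  {c b : ℕ → Config N m → ℂ}

theorem iff_hasSeries : HasExpansion U f d c ↔ ∀ w₀ ∈ U,
    HasSeries (𝓝 w₀ ×ˢ Bornology.cobounded ℂ) (fun p => p.2 ^ (-d) * f p.1 p.2)
      (fun w => PowerSeries.mk fun s => c s w) := by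
  refine forall₂_congr fun w₀ _ => forall_congr' fun k => ?_
  have hz := eventually_snd_ne_zero (𝓝 w₀)
  have key : ∀ z : ℂ, z ≠ 0 → ∀ s : ℕ, z ^ (-d) * z ^ (d - (s : ℤ)) = z⁻¹ ^ s := fun z hz s => by
    rw [← zpow_add₀ hz, show -d + (d - (s : ℤ)) = -s by ring, zpow_neg, zpow_natCast, inv_pow]
  have key' : ∀ z : ℂ, z ≠ 0 → ∀ s : ℕ, z ^ d * z⁻¹ ^ s = z ^ (d - (s : ℤ)) := fun z hz s => by
    rw [← key z hz, ← mul_assoc, ← zpow_add₀ hz, add_neg_cancel, zpow_zero, one_mul]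
  constructor <;> intro h
  · refine ((isBigO_refl (fun p : Config N m × ℂ => p.2 ^ (-d)) _).mul h).congr' ?_ ?_ <;>
    filter_upwards [hz] with p hp
    · rw [mul_sub, Finset.mul_sum]
      congr 1
      refine Finset.sum_congr rfl fun s _ => ?_
      rw [PowerSeries.coeff_mk, mul_left_comm, key _ hp]
    · rw [key _ hp]
  · refine ((isBigO_refl (fun p : Config N m × ℂ => p.2 ^ d) _).mul h).congr' ?_ ?_ <;>
    filter_upwards [hz] with p hp
    · rw [mul_sub, Finset.mul_sum, ← mul_assoc, ← zpow_add₀ hp, add_neg_cancel, zpow_zero, one_mul]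
      congr 1
      refine Finset.sum_congr rfl fun s _ => ?_
      rw [PowerSeries.coeff_mk, mul_left_comm, key' _ hp]
    · rw [key' _ hp]

variable [NeZero N]

theorem isBigO_one_of_contDiffOn (hU : IsOpen U) {h : Config N m → ℂ} (hh : ContDiffOn ℂ ∞ h U)
    {w₀ : Config N m} (hw : w₀ ∈ U) {l : Filter ℂ} :
    (fun p : Config N m × ℂ => h p.1) =O[𝓝 w₀ ×ˢ l] (fun _ => (1 : ℂ)) :=
  ((hh.continuousOn.continuousAt (hU.mem_nhds hw)).tendsto.comp tendsto_fst).isBigO_one ℂ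

theorem tendsto (hU : IsOpen U) (hf : HasExpansion U f d c) (hc : ContDiffOn ℂ ∞ (c 0) U)
    {w₀ : Config N m} (hw : w₀ ∈ U) :
    Tendsto (fun p : Config N m × ℂ => p.2 ^ (-d) * f p.1 p.2) (𝓝 w₀ ×ˢ Bornology.cobounded ℂ)
      (𝓝 (c 0 w₀)) := by
  have h1 := ((iff_hasSeries.1 hf w₀ hw) 1).trans_tendsto
    (by simpa using tendsto_inv_snd_cobounded (𝓝 w₀))
  have h2 : Tendsto (fun p : Config N m × ℂ => c 0 p.1) (𝓝 w₀ ×ˢ Bornology.cobounded ℂ)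
      (𝓝 (c 0 w₀)) :=
    (hc.continuousOn.continuousAt (hU.mem_nhds hw)).tendsto.comp tendsto_fst
  simpa using h1.add h2

theorem eventually_ne_zero (hU : IsOpen U) (hf : HasExpansion U f d c)
    (hc : ContDiffOn ℂ ∞ (c 0) U) {w₀ : Config N m} (hw : w₀ ∈ U) (h0 : c 0 w₀ ≠ 0) :
    ∀ᶠ p in 𝓝 w₀ ×ˢ Bornology.cobounded ℂ, f p.1 p.2 ≠ 0 :=
  ((hf.tendsto hU hc hw).eventually_ne h0).mono fun _ hp => right_ne_zero_of_mul hp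

theorem tendsto_normalized (hU : IsOpen U) (hf : HasExpansion U f d c)
    (hc : ContDiffOn ℂ ∞ (c 0) U) {w₀ : Config N m} (hw : w₀ ∈ U) (h0 : c 0 w₀ ≠ 0) :
    Tendsto (fun p : Config N m × ℂ => p.2 ^ (-d) * f p.1 p.2 / c 0 p.1)
      (𝓝 w₀ ×ˢ Bornology.cobounded ℂ) (𝓝 1) := by
  have h2 : Tendsto (fun p : Config N m × ℂ => c 0 p.1) (𝓝 w₀ ×ˢ Bornology.cobounded ℂ)
      (𝓝 (c 0 w₀)) :=
    (hc.continuousOn.continuousAt (hU.mem_nhds hw)).tendsto.comp tendsto_fst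
  have h := (hf.tendsto hU hc hw).div h2 h0
  rw [div_self h0] at h
  exact h

/-- The quotient of two expansions, the denominator having a nonvanishing leading coefficient. -/
theorem div (hU : IsOpen U) (hf : HasExpansion U f d c) (hg : HasExpansion U g e b)
    (hc : ∀ s, ContDiffOn ℂ ∞ (c s) U) (hb : ∀ s, ContDiffOn ℂ ∞ (b s) U)
    (h0 : ∀ w ∈ U, b 0 w ≠ 0) :
    ∃ a : ℕ → Config N m → ℂ, (∀ s, ContDiffOn ℂ ∞ (a s) U) ∧ (∀ w, a 0 w = c 0 w / b 0 w) ∧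
      HasExpansion U (fun w z => f w z / g w z) (d - e) a := by
  have hb' : ∀ s, ContDiffOn ℂ ∞
      (fun w => PowerSeries.coeff s (PowerSeries.mk fun s => b s w)) U := fun s => by
    simpa using hb s
  have hc' : ∀ s, ContDiffOn ℂ ∞
      (fun w => PowerSeries.coeff s (PowerSeries.mk fun s => c s w)) U := fun s => by
    simpa using hc s
  have hb0 : ∀ w ∈ U, PowerSeries.constantCoeff (PowerSeries.mk fun s => b s w) ≠ 0 :=
    fun w hw => by simpa using h0 w hw
  have hi := contDiffOn_coeff_inv hb' hb0
  refine ⟨fun s w => PowerSeries.coeff s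
    ((PowerSeries.mk fun s => c s w) * (PowerSeries.mk fun s => b s w)⁻¹),
    contDiffOn_coeff_mul hc' hi, fun w => ?_, iff_hasSeries.2 fun w₀ hw => ?_⟩
  · simp [div_eq_mul_inv]
  · have hne := (hg.tendsto hU (hb 0) hw).eventually_ne (h0 w₀ hw)
    have hgi := ((hg.tendsto hU (hb 0) hw).inv₀ (h0 w₀ hw)).isBigO_one ℂ
    have hUe : ∀ᶠ p in 𝓝 w₀ ×ˢ Bornology.cobounded ℂ, p.1 ∈ U :=
      tendsto_fst.eventually (hU.mem_nhds hw)
    have h := (iff_hasSeries.1 hf w₀ hw).mul ((iff_hasSeries.1 hg w₀ hw).inv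
      (hUe.mono fun p hp => hb0 _ hp) (fun s => isBigO_one_of_contDiffOn hU (hi s) hw) hgi hne)
      (fun s => isBigO_one_of_contDiffOn hU (hc' s) hw)
    refine (h.congr ?_).congr_coeff fun s => Eventually.of_forall fun p => by simp
    filter_upwards [eventually_snd_ne_zero (𝓝 w₀)] with p hp
    rw [neg_sub, mul_inv, ← zpow_neg, neg_neg, zpow_sub₀ hp, zpow_neg]
    ring

/-- The expansion of the logarithm of a normalized functional. -/
theorem log_normalized (hU : IsOpen U) (hf : HasExpansion U f d c)
    (hc : ∀ s, ContDiffOn ℂ ∞ (c s) U) (h0 : ∀ w ∈ U, c 0 w ≠ 0) :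
    ∃ a : ℕ → Config N m → ℂ, (∀ s, ContDiffOn ℂ ∞ (a s) U) ∧
      HasExpansion U (fun w z => Complex.log (z ^ (-d) * f w z / c 0 w)) 0 a := by
  -- The series of `z^{-d} f / c_0 - 1`. Its constant term is set to `0` by hand, because
  -- `log_one_add` asks for this also off `U`, where `c_0` may vanish.
  set C : Config N m → PowerSeries ℂ := fun w =>
    PowerSeries.mk fun s => if s = 0 then 0 else c s w / c 0 w with hC
  have hCs : ∀ s, ContDiffOn ℂ ∞ (fun w => PowerSeries.coeff s (C w)) U := fun s => by
    simp only [hC, PowerSeries.coeff_mk]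
    split_ifs
    · exact contDiffOn_const
    · exact (hc s).div (hc 0) h0
  refine ⟨fun s w => ∑ n ∈ Finset.range (s + 1),
    (-1) ^ (n + 1) / (n : ℂ) * PowerSeries.coeff s (C w ^ n), fun s => ?_,
    iff_hasSeries.2 fun w₀ hw => ?_⟩
  · exact ContDiffOn.sum fun n _ => contDiffOn_const.mul (contDiffOn_coeff_pow hCs n s)
  · have hUe : ∀ᶠ p in 𝓝 w₀ ×ˢ Bornology.cobounded ℂ, p.1 ∈ U :=
      tendsto_fst.eventually (hU.mem_nhds hw)
    have hinv : ContDiffOn ℂ ∞ (fun w => (c 0 w)⁻¹) U := (hc 0).inv h0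
    have h1 := ((HasSeries.const_coeff (fun w => (c 0 w)⁻¹)
      (isBigO_one_of_contDiffOn hU hinv hw)).mul (iff_hasSeries.1 hf w₀ hw) fun s => by
        refine isBigO_one_of_contDiffOn hU (h := fun w => PowerSeries.coeff s
          (PowerSeries.C (c 0 w)⁻¹)) ?_ hw
        simp only [PowerSeries.coeff_C]
        split_ifs
        · exact hinv
        · exact contDiffOn_const).add ((HasSeries.one).const_smul (-1))
    have h2 : HasSeries (𝓝 w₀ ×ˢ Bornology.cobounded ℂ)
        (fun p => (c 0 p.1)⁻¹ * (p.2 ^ (-d) * f p.1 p.2) + -1 * 1) C := by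
      refine h1.congr_coeff fun s => hUe.mono fun p hp => ?_
      have := h0 _ hp
      rcases s with _ | s
      · simp [hC, this]
      · simp [hC, PowerSeries.coeff_one, PowerSeries.coeff_C_mul, div_eq_inv_mul]
    refine (h2.log_one_add (fun w => by simp [hC])
      (fun s => isBigO_one_of_contDiffOn hU (hCs s) hw) (tendsto_inv_snd_cobounded _)).congr ?_
    refine Eventually.of_forall fun p => ?_
    simp only [neg_zero, zpow_zero, one_mul]
    congr 1
    ring

end HasExpansion

/-! ### Products over sites, and smooth branches of the logarithm. -/

theorem siteProd_neg_one (f : ℤ → ℂ) : siteProd f (-1) = 1 := by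
  change (∏ j ∈ Finset.range 0, f (-((j : ℤ) + 1)))⁻¹ = 1
  simp

theorem siteProd_natCast_sub_one (f : ℤ → ℂ) (N : ℕ) :
    siteProd f ((N : ℤ) - 1) = ∏ j ∈ Finset.range N, f (j : ℤ) := by
  rcases N with _ | N
  · simpa using siteProd_neg_one f
  · rw [show ((N + 1 : ℕ) : ℤ) - 1 = Int.ofNat N by simp]
    rfl

theorem siteProd_add_one {f : ℤ → ℂ} (hf : ∀ n, f n ≠ 0) (n : ℤ) :
    siteProd f (n + 1) = siteProd f n * f (n + 1) := by
  rcases n with n | n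
  · change siteProd f (Int.ofNat (n + 1)) = siteProd f (Int.ofNat n) * f (n + 1)
    simp only [siteProd]
    rw [Finset.prod_range_succ _ (n + 1)]
    push_cast
    rfl
  · rcases n with _ | n
    · change siteProd f (Int.ofNat 0) = siteProd f (-1) * f 0
      rw [siteProd_neg_one]
      simp [siteProd]
    · have h : Int.negSucc (n + 1) + 1 = Int.negSucc n := by omega
      rw [h]
      simp only [siteProd]
      rw [Finset.prod_range_succ, show Int.negSucc n = -((n : ℤ) + 1) by omega, mul_inv, mul_assoc,
        inv_mul_cancel₀ (hf _), mul_one]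

theorem eq_siteProd_mul {f P : ℤ → ℂ} (hf : ∀ n, f n ≠ 0) (hP : ∀ n, P (n + 1) = P n * f (n + 1))
    (n : ℤ) : P n = siteProd f n * P (-1) := by
  induction n using Int.inductionOn' (b := -1) with
  | zero => rw [siteProd_neg_one, one_mul]
  | succ k _ ih => rw [hP, ih, siteProd_add_one hf]; ring
  | pred k _ ih =>
    have h1 := hP (k - 1)
    have h2 := siteProd_add_one hf (k - 1)
    rw [sub_add_cancel] at h1 h2
    rw [h1, h2] at ih
    exact mul_right_cancel₀ (hf k) (by linear_combination ih)

/-- The shifted product obeys the same first-order recurrence, so it is a multiple of the original;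
the multiplier is read off at the site `-1`. -/
theorem siteProd_add_period {f : ℤ → ℂ} (hf : ∀ n, f n ≠ 0) {N : ℕ} (hN : ∀ n, f (n + N) = f n)
    (n : ℤ) : siteProd f (n + N) = siteProd f n * siteProd f (N - 1) := by
  have h := eq_siteProd_mul (P := fun n => siteProd f (n + N)) hf (fun n => by
    rw [add_right_comm, siteProd_add_one hf, add_right_comm, hN]) n
  rw [show (-1 : ℤ) + N = N - 1 by ring] at h
  exact h

theorem prod_range_intCast_zmod {M : Type*} [CommMonoid M] (N : ℕ) [NeZero N] (g : ZMod N → M) :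
    ∏ j ∈ Finset.range N, g (((j : ℤ)) : ZMod N) = ∏ n : ZMod N, g n := by
  refine Finset.prod_nbij' (fun j => ((j : ℤ) : ZMod N)) ZMod.val (by simp)
    (fun n _ => Finset.mem_range.2 (ZMod.val_lt n)) (fun j hj => ?_) (fun n _ => ?_) (by simp)
  · simpa using ZMod.val_cast_of_lt (Finset.mem_range.1 hj)
  · simp

/-- Where `b` stays within `π` of `b w₀`, it must equal `b w₀` plus the principal logarithm of `s /
s w₀`, which is smooth near `1`. -/
theorem ContinuousOn.contDiffOn_of_exp {E : Type*} [NormedAddCommGroup E] [NormedSpace ℂ E]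
    {V : Set E} {b s : E → ℂ} (hV : IsOpen V) (hb : ContinuousOn b V) (hs : ContDiffOn ℂ ∞ s V)
    (h : ∀ w ∈ V, Complex.exp (b w) = s w) : ContDiffOn ℂ ∞ b V := by
  intro w₀ hw
  have hb0 : ContinuousAt b w₀ := hb.continuousAt (hV.mem_nhds hw)
  have hs0 : s w₀ ≠ 0 := h w₀ hw ▸ Complex.exp_ne_zero _
  have h1 : ContDiffAt ℂ ∞ (fun w => b w₀ + Complex.log (s w / s w₀)) w₀ := by
    refine contDiffAt_const.add (ContDiffAt.comp w₀ (Complex.contDiffAt_log ?_)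
      ((hs.contDiffAt (hV.mem_nhds hw)).div contDiffAt_const hs0))
    rw [div_self hs0]
    exact Complex.one_mem_slitPlane
  have h2 : b =ᶠ[𝓝 w₀] fun w => b w₀ + Complex.log (s w / s w₀) := by
    have h3 : ∀ᶠ w in 𝓝 w₀, ‖b w - b w₀‖ < Real.pi := by
      have : Tendsto (fun w => ‖b w - b w₀‖) (𝓝 w₀) (𝓝 0) := by
        simpa using (hb0.tendsto.sub_const (b w₀)).norm
      exact this.eventually_lt_const Real.pi_pos
    filter_upwards [h3, hV.mem_nhds hw] with w hw3 hwV
    have him := (Complex.abs_im_le_norm (b w - b w₀)).trans_lt hw3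
    rw [← h w hwV, ← h w₀ hw, ← Complex.exp_sub,
      Complex.log_exp (abs_lt.1 him).1 (abs_lt.1 him).2.le]
    ring
  exact (h1.congr_of_eventuallyEq h2).contDiffWithinAt

/-! ### Shift by a period, and derivatives along trajectories. -/

namespace LocalSystem

variable {N m : ℕ}

theorem adjoint_congr_shift (K : LocalSystem N m) (w : Config N m) {φ ψ : ℤ → Fin m → ℂ}
    {c : ℂ} (h : ∀ n k, φ (n + N) k = ψ n k * c) (n : ℤ) (i : Fin m) :
    K.adjoint w φ (n + N) i = K.adjoint w ψ n i * c := by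
  simp only [adjoint, Finset.sum_mul]
  refine Finset.sum_congr rfl fun j _ => Finset.sum_congr rfl fun k _ => ?_
  rw [show n + (N : ℤ) - j = n - j + N by ring, h]
  simp [mul_assoc]

theorem IsTrajectory.mono [NeZero N] {K : LocalSystem N m} {U V : Set (Config N m)} {I : Set ℝ}
    {w : ℝ → Config N m} (h : K.IsTrajectory V I w) (hVU : V ⊆ U) : K.IsTrajectory U I w :=
  ⟨h.isOpen, h.ordConnected, fun t ht => hVU (h.mem t ht), h.hasDerivAt⟩

theorem IsTrajectory.differentiableAt_comp [NeZero N] {K : LocalSystem N m} {U : Set (Config N m)}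
    {I : Set ℝ} {w : ℝ → Config N m} (h : K.IsTrajectory U I w) {t : ℝ} (ht : t ∈ I)
    {E : Type*} [NormedAddCommGroup E] [NormedSpace ℂ E] {F : Config N m → E}
    (hF : DifferentiableAt ℂ F (w t)) :
    HasDerivAt (fun s => F (w s)) (fderiv ℂ F (w t) (K.field (w t))) t :=
  (hF.hasFDerivAt.restrictScalars ℝ).comp_hasDerivAt t (h.hasDerivAt t ht)

theorem IsTrajectory.tendsto_prod [NeZero N] {K : LocalSystem N m} {U : Set (Config N m)}
    {I : Set ℝ} {w : ℝ → Config N m} (h : K.IsTrajectory U I w) {t : ℝ} (ht : t ∈ I)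
    (l : Filter ℂ) : Tendsto (fun p : ℝ × ℂ => (w p.1, p.2)) (𝓝 t ×ˢ l) (𝓝 (w t) ×ˢ l) :=
  (((h.hasDerivAt t ht).continuousAt.tendsto.comp tendsto_fst).prodMk tendsto_snd)

end LocalSystem

/-! ### From asymptotic solutions to conservation laws. -/

namespace LaxAnsatz

variable {N m : ℕ} [NeZero N] [NeZero m] {U : Set (Config N m)} {K : LocalSystem N m}
  {I : Set ℝ} {w : ℝ → Config N m} {om : ℝ → ℂ → ℂ}

theorem eventually_sigma_ne_zero (A : LaxAnsatz U) (hU : IsOpen U) {w₀ : Config N m} (hw : w₀ ∈ U) :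
    ∀ᶠ p in 𝓝 w₀ ×ˢ Bornology.cobounded ℂ, ∀ n, A.σ n p.1 p.2 ≠ 0 :=
  eventually_all.2 fun n => (A.s_expansion n).eventually_ne_zero hU (A.sCoeff_smooth 0 n) hw
    (A.sCoeff_zero_ne n w₀ hw)

/-- The residuals at the sites `-1` and `N - 1` differ by the logarithmic derivative of
`∏_n σ_n`. -/
theorem residual_sub_residual (A : LaxAnsatz U) {t : ℝ} {z : ℂ}
    (hσ : ∀ n, A.σ n (w t) z ≠ 0) (hom : DifferentiableAt ℝ (fun t => om t z) t)
    (hQ : DifferentiableAt ℝ (fun t => ∏ n, A.σ n (w t) z) t) :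
    let R : ℤ → ℂ := fun n => (deriv (fun t => A.covector w om t z n 0) t
            + K.adjoint (w t) (A.covector w om t z) n 0)
          / (Complex.exp (om t z) * siteProd (fun j : ℤ => A.σ (j : ZMod N) (w t) z) n)
    R (-1 + N) - R (-1) = deriv (fun t => ∏ n, A.σ n (w t) z) t / ∏ n, A.σ n (w t) z := by
  have hQP : ∀ t, siteProd (fun j : ℤ => A.σ (j : ZMod N) (w t) z) (N - 1)
      = ∏ n, A.σ n (w t) z := fun t => by
    rw [siteProd_natCast_sub_one, prod_range_intCast_zmod N fun n => A.σ n (w t) z]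
  have hP : ∀ n, siteProd (fun j : ℤ => A.σ (j : ZMod N) (w t) z) (n + N)
      = siteProd (fun j : ℤ => A.σ (j : ZMod N) (w t) z) n * ∏ n, A.σ n (w t) z := fun n => by
    rw [← hQP, siteProd_add_period (fun n => hσ _) (fun n => by simp)]
  have hadj : K.adjoint (w t) (A.covector w om t z) (-1 + N) 0
      = K.adjoint (w t) (A.covector w om t z) (-1) 0 * ∏ n, A.σ n (w t) z := by
    refine K.adjoint_congr_shift (w t) (fun n k => ?_) _ _
    simp only [covector, hP]
    simp [mul_assoc]
  have hQ0 : ∏ n, A.σ n (w t) z ≠ 0 := Finset.prod_ne_zero_iff.2 fun n _ => hσ n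
  -- With `Q = ∏ σ_n`, the first component is `e^om` at the site `-1` and `e^om Q` at `N - 1`. The
  -- adjoint terms agree after normalization, so the difference is the logarithmic derivative of
  -- `e^om Q` minus that of `e^om`.
  have h1 : (fun t => A.covector w om t z (-1) 0) = fun t => Complex.exp (om t z) := by
    funext t
    simp [covector, siteProd_neg_one, A.a_first]
  have h2 : (fun t => A.covector w om t z (-1 + N) 0)
      = fun t => Complex.exp (om t z) * ∏ n, A.σ n (w t) z := by
    funext t
    rw [show -1 + (N : ℤ) = N - 1 by ring, covector, hQP, A.a_first, one_mul]
  intro R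
  have hd := deriv_fun_mul hom.cexp hQ
  simp only [R]
  rw [hadj, h1, h2, hd, hP, siteProd_neg_one]
  have := Complex.exp_ne_zero (om t z)
  field_simp
  ring

/-- The exponential of the generator is a power of `z` times `∏ σ_n`, so the logarithmic derivative
does not see the branches. The generator is differentiable because the normalized factors are close
to `1`, hence in the slit plane. -/
theorem eventually_hasDerivAt_generator (A : LaxAnsatz U) (hU : IsOpen U) {V : Set (Config N m)}
    (hV : IsOpen V) (hVU : V ⊆ U) {b : ZMod N → Config N m → ℂ} (hb : ∀ n, ContinuousOn (b n) V)
    (hbs : ∀ n, ∀ w ∈ V, Complex.exp (b n w) = A.sCoeff 0 n w) (hw : K.IsTrajectory V I w)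
    {t₀ : ℝ} (ht₀ : t₀ ∈ I) :
    ∀ᶠ p in 𝓝 t₀ ×ˢ Bornology.cobounded ℂ, (∀ n, A.σ n (w p.1) p.2 ≠ 0) ∧
      DifferentiableAt ℝ (fun t => ∏ n, A.σ n (w t) p.2) p.1 ∧
      HasDerivAt (fun t => A.generator b (w t) p.2)
        (deriv (fun t => ∏ n, A.σ n (w t) p.2) p.1 / ∏ n, A.σ n (w p.1) p.2) p.1 := by
  have hwU := hVU (hw.mem t₀ ht₀)
  have hT := hw.tendsto_prod ht₀ (Bornology.cobounded ℂ)
  have hI : ∀ᶠ p in 𝓝 t₀ ×ˢ Bornology.cobounded ℂ, p.1 ∈ I :=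
    tendsto_fst.eventually (hw.isOpen.mem_nhds ht₀)
  have hslit : ∀ᶠ p in 𝓝 (w t₀) ×ˢ Bornology.cobounded ℂ, ∀ n,
      p.2 ^ (-A.sOrder) * A.σ n p.1 p.2 / A.sCoeff 0 n p.1 ∈ Complex.slitPlane :=
    eventually_all.2 fun n => ((A.s_expansion n).tendsto_normalized hU (A.sCoeff_smooth 0 n) hwU
      (A.sCoeff_zero_ne n _ hwU)).eventually
        (Complex.isOpen_slitPlane.mem_nhds Complex.one_mem_slitPlane)
  filter_upwards [hI, eventually_prod_nhds (hT.eventually (A.eventually_sigma_ne_zero hU hwU)),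
    hT.eventually (A.s_smooth _ hwU), hT.eventually hslit,
    eventually_snd_ne_zero (𝓝 t₀)] with p hpI hσ hs hsl hz
  have hwp := hw.mem p.1 hpI
  have hσd : ∀ n, DifferentiableAt ℝ (fun t => A.σ n (w t) p.2) p.1 := fun n =>
    (hw.differentiableAt_comp hpI ((hs n).differentiableAt (by simp))).differentiableAt
  have hQ : DifferentiableAt ℝ (fun t => ∏ n, A.σ n (w t) p.2) p.1 :=
    DifferentiableAt.fun_finsetProd fun n _ => hσd n
  have hc : ∀ n, DifferentiableAt ℝ (fun t => A.sCoeff 0 n (w t)) p.1 := fun n =>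
    (hw.differentiableAt_comp hpI (((A.sCoeff_smooth 0 n).contDiffAt
      (hU.mem_nhds (hVU hwp))).differentiableAt (by simp))).differentiableAt
  have hbd : ∀ n, DifferentiableAt ℝ (fun t => b n (w t)) p.1 := fun n =>
    (hw.differentiableAt_comp hpI ((((hb n).contDiffOn_of_exp hV ((A.sCoeff_smooth 0 n).mono hVU)
      (hbs n)).contDiffAt (hV.mem_nhds hwp)).differentiableAt (by simp))).differentiableAt
  have hG : DifferentiableAt ℝ (fun t => A.generator b (w t) p.2) p.1 := by
    refine DifferentiableAt.fun_sum fun n _ => (hbd n).add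
      ((((hσd n).const_mul _).fun_div (hc n)
        (A.sCoeff_zero_ne n _ (hVU hwp))).hasDerivAt.clog_real (hsl n)).differentiableAt
  refine ⟨hσ.self_of_nhds, hQ, ?_⟩
  have hQ0 : ∏ n, A.σ n (w p.1) p.2 ≠ 0 :=
    Finset.prod_ne_zero_iff.2 fun n _ => hσ.self_of_nhds n
  have hexp : ∀ᶠ t in 𝓝 p.1, Complex.exp (A.generator b (w t) p.2)
      = (∏ _n : ZMod N, p.2 ^ (-A.sOrder)) * ∏ n, A.σ n (w t) p.2 := by
    filter_upwards [hσ, hw.isOpen.mem_nhds hpI] with t ht htI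
    have htV := hw.mem t htI
    rw [generator, Complex.exp_sum, ← Finset.prod_mul_distrib]
    exact Finset.prod_congr rfl fun n _ =>
      A.exp_logDensity (hVU htV) (hbs n _ htV) hz (ht n)
  have h1 := hG.hasDerivAt.cexp.unique ((hQ.hasDerivAt.const_mul _).congr_of_eventuallyEq hexp)
  rw [hexp.self_of_nhds] at h1
  have hc0 : (∏ _n : ZMod N, p.2 ^ (-A.sOrder)) ≠ 0 :=
    Finset.prod_ne_zero_iff.2 fun n _ => zpow_ne_zero _ hz
  have h2 : deriv (fun t => A.generator b (w t) p.2) p.1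
      = deriv (fun t => ∏ n, A.σ n (w t) p.2) p.1 / ∏ n, A.σ n (w p.1) p.2 := by
    rw [eq_div_iff hQ0]
    exact mul_left_cancel₀ hc0 (by linear_combination h1)
  rw [← h2]
  exact hG.hasDerivAt

theorem SolvesAsymptotically.logDeriv_isBigO {A : LaxAnsatz U} (hA : A.SolvesAsymptotically K I w om)
    {t₀ : ℝ} (ht₀ : t₀ ∈ I)
    (h : ∀ᶠ p in 𝓝 t₀ ×ˢ Bornology.cobounded ℂ, (∀ n, A.σ n (w p.1) p.2 ≠ 0) ∧
      DifferentiableAt ℝ (fun t => ∏ n, A.σ n (w t) p.2) p.1) (k : ℕ) :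
    (fun p : ℝ × ℂ => deriv (fun t => ∏ n, A.σ n (w t) p.2) p.1 / ∏ n, A.σ n (w p.1) p.2)
      =O[𝓝 t₀ ×ˢ Bornology.cobounded ℂ] (fun p => p.2 ^ (-(k : ℤ))) := by
  obtain ⟨hd, hR⟩ := hA t₀ ht₀
  refine ((hR (-1 + N) 0 k).sub (hR (-1) 0 k)).congr' ?_ EventuallyEq.rfl
  filter_upwards [h, hd] with p hp hdp
  exact A.residual_sub_residual hp.1 hdp hp.2

/-- The mean value inequality in `t`, with one bound on the derivative valid on a ball around `t₀`
for all large `z`. The ball may depend on `k`, which is harmless because each coefficient uses a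
single `k`. -/
theorem generator_sub_isBigO {A : LaxAnsatz U} (hU : IsOpen U) {V : Set (Config N m)}
    (hV : IsOpen V) (hVU : V ⊆ U) {b : ZMod N → Config N m → ℂ} (hb : ∀ n, ContinuousOn (b n) V)
    (hbs : ∀ n, ∀ w ∈ V, Complex.exp (b n w) = A.sCoeff 0 n w) (hw : K.IsTrajectory V I w)
    (hA : A.SolvesAsymptotically K I w om) {t₀ : ℝ} (ht₀ : t₀ ∈ I) (k : ℕ) :
    ∀ᶠ t in 𝓝 t₀, (fun z => A.generator b (w t₀) z - A.generator b (w t) z)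
      =O[Bornology.cobounded ℂ] (fun z => z⁻¹ ^ k) := by
  have hev := A.eventually_hasDerivAt_generator hU hV hVU hb hbs hw ht₀
  obtain ⟨C, hC⟩ := (hA.logDeriv_isBigO ht₀ (hev.mono fun p hp => ⟨hp.1, hp.2.1⟩) k).bound
  obtain ⟨P, hP, B, hB, hPB⟩ := eventually_prod_iff.1 (hev.and hC)
  obtain ⟨ε, hε, hεP⟩ := Metric.eventually_nhds_iff_ball.1 hP
  filter_upwards [Metric.ball_mem_nhds t₀ hε] with t ht
  refine IsBigO.of_bound (C * ‖t₀ - t‖) (hB.mono fun z hz => ?_)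
  have := Convex.norm_image_sub_le_of_norm_hasDerivWithin_le
    (f' := fun s => deriv (fun t => ∏ n, A.σ n (w t) z) s / ∏ n, A.σ n (w s) z)
    (f := fun s => A.generator b (w s) z) (C := C * ‖z ^ (-(k : ℤ))‖)
    (fun s hs => (hPB (hεP s hs) hz).1.2.2.hasDerivWithinAt)
    (fun s hs => (hPB (hεP s hs) hz).2) (convex_ball t₀ ε) ht (Metric.mem_ball_self hε)
  refine this.trans_eq ?_
  rw [zpow_neg, zpow_natCast, inv_pow]
  ring

theorem exists_expansion_generator (A : LaxAnsatz U) (hU : IsOpen U) {V : Set (Config N m)}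
    (hV : IsOpen V) (hVU : V ⊆ U) {b : ZMod N → Config N m → ℂ} (hb : ∀ n, ContinuousOn (b n) V)
    (hbs : ∀ n, ∀ w ∈ V, Complex.exp (b n w) = A.sCoeff 0 n w) :
    ∃ γ : ℕ → Config N m → ℂ, (∀ j, ContDiffOn ℂ ∞ (γ j) V) ∧
      HasExpansion V (A.generator b) 0 γ := by
  choose q hqs hq using fun n => (A.s_expansion n).log_normalized hU
    (fun s => A.sCoeff_smooth s n) (A.sCoeff_zero_ne n)
  have hbd : ∀ n, ContDiffOn ℂ ∞ (b n) V := fun n =>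
    (hb n).contDiffOn_of_exp hV ((A.sCoeff_smooth 0 n).mono hVU) (hbs n)
  have hexp : HasExpansion V (A.generator b) 0
      (fun s w => ∑ n, ((if s = 0 then b n w else 0) + q n s w)) := by
    refine HasExpansion.iff_hasSeries.2 fun w₀ hw => ?_
    have h1 := HasSeries.sum Finset.univ fun n _ =>
      (HasSeries.const_coeff (b n) (HasExpansion.isBigO_one_of_contDiffOn hV (hbd n) hw)).add
        (HasExpansion.iff_hasSeries.1 (hq n) w₀ (hVU hw))
    refine (h1.congr (Eventually.of_forall fun p => ?_)).congr_coeff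
      fun s => Eventually.of_forall fun p => ?_
    · simp [generator, logDensity]
    · simp [PowerSeries.coeff_C]
  refine ⟨_, fun j => ContDiffOn.sum fun n _ => ContDiffOn.add ?_ ((hqs n j).mono hVU), hexp⟩
  · split_ifs
    · exact hbd n
    · exact contDiffOn_const

theorem generatesConservationLaws (A : LaxAnsatz U) (hU : IsOpen U)
    (hA : ∀ (I : Set ℝ) (w : ℝ → Config N m), K.IsTrajectory U I w →
        ∃ om : ℝ → ℂ → ℂ, A.SolvesAsymptotically K I w om) :
    A.GeneratesConservationLaws K := by
  intro V b hV hVU hb hbs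
  obtain ⟨γ, hγ, hexp⟩ := A.exists_expansion_generator hU hV hVU hb hbs
  refine ⟨γ, hγ, hexp, ?_⟩
  intro j I w hw
  obtain ⟨om, hom⟩ := hA I w (hw.mono hVU)
  have hser : ∀ t ∈ I, ∀ k, (fun z => A.generator b (w t) z
      - ∑ s ∈ Finset.range k, γ s (w t) * z⁻¹ ^ s) =O[Bornology.cobounded ℂ] (fun z => z⁻¹ ^ k) := by
    intro t ht k
    have hT : Tendsto (fun z : ℂ => (w t, z)) (Bornology.cobounded ℂ)
        (𝓝 (w t) ×ˢ Bornology.cobounded ℂ) :=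
      Tendsto.prodMk (tendsto_const_nhds) tendsto_id
    simpa [Function.comp_def] using
      (HasExpansion.iff_hasSeries.1 hexp _ (hw.mem t ht) k).comp_tendsto hT
  induction j using Nat.strong_induction_on with
  | _ j ih =>
    intro s hs t ht
    refine hw.ordConnected.isPreconnected.induction₂ (fun s t => γ j (w s) = γ j (w t)) ?_
      (fun _ _ _ _ _ _ => Eq.trans) (fun _ _ _ _ => Eq.symm) hs ht
    intro t₀ ht₀
    -- Local constancy suffices, as the interval is connected. At order `j + 1` the coefficients
    -- below `j` cancel by induction, so the increment of `γ j` times `z^{-j}` is `O(z^{-j-1})` and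
    -- must vanish.
    filter_upwards [mem_nhdsWithin_of_mem_nhds (generator_sub_isBigO hU hV hVU hb hbs hw hom ht₀
      (j + 1)), self_mem_nhdsWithin] with t ht htI
    refine sub_eq_zero.1 (eq_zero_of_mul_inv_pow_isBigO (k := j) ?_)
    refine ((ht.sub (hser t₀ ht₀ (j + 1))).add (hser t htI (j + 1))).congr_left fun z => ?_
    simp only [Finset.sum_range_succ]
    rw [Finset.sum_congr rfl fun i hi => by rw [ih i (Finset.mem_range.1 hi) t₀ ht₀ t htI]]
    ring

end LaxAnsatz

/-! ### Termwise differentiation of expansions. -/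

/-- Cauchy's estimate on the complex line through `w` in the direction `v`. -/
theorem norm_fderiv_apply_le {E : Type*} [NormedAddCommGroup E] [NormedSpace ℂ E] {h : E → ℂ}
    {w v : E} {ρ M : ℝ} (hρ : 0 < ρ) (hd : ∀ ζ : ℂ, ‖ζ‖ ≤ ρ → DifferentiableAt ℂ h (w + ζ • v))
    (hM : ∀ ζ : ℂ, ‖ζ‖ ≤ ρ → ‖h (w + ζ • v)‖ ≤ M) : ‖fderiv ℂ h w v‖ ≤ M / ρ := by
  have hw : DifferentiableAt ℂ h w := by simpa using hd 0 (by simpa using hρ.le)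
  have hline : ∀ ζ : ℂ, DifferentiableAt ℂ (fun ζ : ℂ => w + ζ • v) ζ := fun ζ => by fun_prop
  have hder : deriv (fun ζ : ℂ => h (w + ζ • v)) 0 = fderiv ℂ h w v := by
    have h1 : HasDerivAt (fun ζ : ℂ => w + ζ • v) v 0 := by
      simpa using ((hasDerivAt_id (0 : ℂ)).smul_const v).const_add w
    have h2 : HasFDerivAt h (fderiv ℂ h w) (w + (0 : ℂ) • v) := by simpa using hw.hasFDerivAt
    exact (h2.comp_hasDerivAt (0 : ℂ) h1).deriv
  rw [← hder]
  refine Complex.norm_deriv_le_of_forall_mem_sphere_norm_le hρ ?_ fun ζ hζ =>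
    hM ζ (by simpa using (mem_sphere_zero_iff_norm.1 hζ).le)
  refine DifferentiableOn.diffContOnCl fun ζ hζ => ?_
  rw [closure_ball _ hρ.ne', mem_closedBall_zero_iff] at hζ
  exact ((hd ζ hζ).comp ζ (hline ζ)).differentiableWithinAt

theorem contDiffOn_fderiv_apply {E : Type*} [NormedAddCommGroup E] [NormedSpace ℂ E] {h : E → ℂ}
    {U : Set E} (hU : IsOpen U) (hh : ContDiffOn ℂ ∞ h U) (v : E) :
    ContDiffOn ℂ ∞ (fun w => fderiv ℂ h w v) U :=
  (hh.fderiv_of_isOpen hU (by simp)).clm_apply contDiffOn_const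

namespace HasExpansion

variable {N m : ℕ} {U : Set (Config N m)} {f : Config N m → ℂ → ℂ} {d : ℤ}
  {c : ℕ → Config N m → ℂ}

/-- An expansion whose first `q` coefficients vanish. -/
theorem shift (hU : IsOpen U) (hf : HasExpansion U f d c) {q : ℕ}
    (h0 : ∀ w ∈ U, ∀ j < q, c j w = 0) :
    HasExpansion U f (d - q) (fun s => c (s + q)) := by
  intro w₀ hw k
  refine (hf w₀ hw (q + k)).congr' ?_ (Eventually.of_forall fun p => ?_)
  · filter_upwards [tendsto_fst.eventually (hU.mem_nhds hw)] with p hp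
    rw [Finset.sum_range_add, Finset.sum_eq_zero (s := Finset.range q) fun j hj => by
      rw [h0 _ hp j (Finset.mem_range.1 hj), zero_mul], zero_add]
    congr 1
    refine Finset.sum_congr rfl fun s _ => ?_
    rw [add_comm q s]
    push_cast
    congr 2
    ring
  · simp only
    push_cast
    congr 1
    ring

/-- Expansions of holomorphic functionals may be differentiated term by term. -/
theorem fderiv_apply [NeZero N] (hU : IsOpen U) (hf : HasExpansion U f d c)
    (hfd : ∀ᶠ z in Bornology.cobounded ℂ, DifferentiableOn ℂ (fun w => f w z) U)
    (hc : ∀ s, ContDiffOn ℂ ∞ (c s) U) (v : Config N m) :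
    HasExpansion U (fun w z => fderiv ℂ (fun w => f w z) w v) d
      (fun s w => fderiv ℂ (c s) w v) := by
  intro w₀ hw k
  obtain ⟨C, hC⟩ := (hf w₀ hw k).bound
  obtain ⟨P, hP, B, hB, hPB⟩ := eventually_prod_iff.1 hC
  obtain ⟨ε, hε, hεP⟩ := Metric.eventually_nhds_iff_ball.1 (hP.and (hU.mem_nhds hw))
  -- Discs of radius `ρ` in the direction `v` about points of the half ball stay in the ball where
  -- the remainder is bounded; the `+ 1` allows `v = 0`.
  set ρ : ℝ := ε / 2 / (‖v‖ + 1) with hρ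
  have hρ0 : 0 < ρ := by positivity
  have hρv : ρ * ‖v‖ < ε / 2 := by
    have : ρ * (‖v‖ + 1) = ε / 2 := by rw [hρ]; field_simp
    nlinarith
  have hball : ∀ w ∈ Metric.ball w₀ (ε / 2), ∀ ζ : ℂ, ‖ζ‖ ≤ ρ → w + ζ • v ∈ Metric.ball w₀ ε := by
    intro w hw ζ hζ
    rw [mem_ball_iff_norm] at hw ⊢
    calc ‖w + ζ • v - w₀‖ = ‖(w - w₀) + ζ • v‖ := by congr 1; abel
      _ ≤ ‖w - w₀‖ + ‖ζ • v‖ := norm_add_le _ _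
      _ < ε / 2 + ε / 2 := by
        refine add_lt_add_of_lt_of_le hw ?_
        rw [norm_smul]
        exact (mul_le_mul_of_nonneg_right hζ (norm_nonneg v)).trans hρv.le
      _ = ε := add_halves ε
  refine IsBigO.of_bound (C / ρ) (eventually_prod_iff.2 ⟨_, Metric.ball_mem_nhds w₀ (half_pos hε),
    _, hB.and hfd, fun {w} hwb z hz => ?_⟩)
  have hfz : ∀ x ∈ U, DifferentiableAt ℂ (fun w => f w z) x := fun x hx =>
    hz.2.differentiableAt (hU.mem_nhds hx)
  have hcz : ∀ x ∈ U, ∀ s, DifferentiableAt ℂ (c s) x := fun x hx s =>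
    ((hc s).contDiffAt (hU.mem_nhds hx)).differentiableAt (by simp)
  have hwU : w ∈ U := (hεP w (Metric.ball_subset_ball (half_le_self hε.le) hwb)).2
  have hsum : ∀ x ∈ U, DifferentiableAt ℂ
      (fun w => ∑ s ∈ Finset.range k, c s w * z ^ (d - (s : ℤ))) x := fun x hx =>
    DifferentiableAt.fun_sum fun s _ => (hcz x hx s).mul_const _
  have hder : fderiv ℂ (fun w => f w z - ∑ s ∈ Finset.range k, c s w * z ^ (d - (s : ℤ))) w v
      = fderiv ℂ (fun w => f w z) w v
        - ∑ s ∈ Finset.range k, fderiv ℂ (c s) w v * z ^ (d - (s : ℤ)) := by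
    rw [fderiv_fun_sub (hfz w hwU) (hsum w hwU),
      fderiv_fun_sum fun s _ => (hcz w hwU s).mul_const _]
    simp only [sub_apply, sum_apply]
    congr 1
    refine Finset.sum_congr rfl fun s _ => ?_
    rw [fderiv_mul_const (hcz w hwU s)]
    simp [mul_comm]
  simp only
  rw [← hder]
  refine (norm_fderiv_apply_le hρ0 (M := C * ‖z ^ (d - (k : ℤ))‖) (fun ζ hζ => ?_)
    fun ζ hζ => ?_).trans_eq (by ring)
  · have hx := (hεP _ (hball w hwb ζ hζ)).2
    exact (hfz _ hx).fun_sub (hsum _ hx)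
  · exact hPB (hεP _ (hball w hwb ζ hζ)).1 hz.1

end HasExpansion

/-! ### Conservation of the trace of the monodromy matrix. -/

namespace LaxRepresentation

variable {N m r : ℕ} [NeZero N] {K : LocalSystem N m} {U : Set (Config N m)}

theorem contDiffOn_fundamental (L : LaxRepresentation K U r) {z : ℂ}
    (hz : ∀ n i j, ContDiffOn ℂ ∞ (fun w => L.l n w z i j) U) (n : ZMod N) (k : ℕ) (i j : Fin r) :
    ContDiffOn ℂ ∞ (fun w => L.fundamental w z n k i j) U := by
  induction k generalizing i j with
  | zero => exact contDiffOn_const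
  | succ k ih =>
    simp only [fundamental, Matrix.mul_apply]
    exact ContDiffOn.sum fun a _ => (hz _ _ _).mul (ih _ _)

theorem contDiffOn_trace_monodromy (L : LaxRepresentation K U r) {z : ℂ}
    (hz : ∀ n i j, ContDiffOn ℂ ∞ (fun w => L.l n w z i j) U) (n : ZMod N) :
    ContDiffOn ℂ ∞ (fun w => (L.monodromy n w z).trace) U :=
  ContDiffOn.sum fun i _ => L.contDiffOn_fundamental hz n N i i

/-- The contributions of `p` at intermediate sites telescope. Over a full period the two end
matrices coincide, which yields a commutator, of trace zero. -/
theorem fderiv_fundamental (L : LaxRepresentation K U r) (hU : IsOpen U) {z : ℂ}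
    (hz : ∀ n i j, ContDiffOn ℂ ∞ (fun w => L.l n w z i j) U)
    (hp : ∀ w ∈ U, ∀ n i j, fderiv ℂ (fun v => L.l n v z i j) w (K.field w)
      = (L.p (n + 1) w z * L.l n w z - L.l n w z * L.p n w z) i j)
    {w : Config N m} (hw : w ∈ U) (n : ZMod N) (k : ℕ) (i j : Fin r) :
    fderiv ℂ (fun v => L.fundamental v z n k i j) w (K.field w)
      = (L.p (n + k) w z * L.fundamental w z n k - L.fundamental w z n k * L.p n w z) i j := by
  induction k generalizing i j with
  | zero => simp [fundamental]
  | succ k ih =>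
    have hl : ∀ a, DifferentiableAt ℂ (fun v => L.l (n + k) v z i a) w := fun a =>
      ((hz _ _ _).contDiffAt (hU.mem_nhds hw)).differentiableAt (by simp)
    have hF : ∀ a, DifferentiableAt ℂ (fun v => L.fundamental v z n k a j) w := fun a =>
      ((L.contDiffOn_fundamental hz n k a j).contDiffAt (hU.mem_nhds hw)).differentiableAt (by simp)
    have h1 : fderiv ℂ (fun v => L.fundamental v z n (k + 1) i j) w (K.field w)
        = ((L.p (n + k + 1) w z * L.l (n + k) w z - L.l (n + k) w z * L.p (n + k) w z)
            * L.fundamental w z n k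
          + L.l (n + k) w z *
            (L.p (n + k) w z * L.fundamental w z n k - L.fundamental w z n k * L.p n w z)) i j := by
      simp only [fundamental, Matrix.mul_apply (M := L.l _ _ _)]
      rw [fderiv_fun_sum fun a _ => (hl a).fun_mul (hF a), sum_apply,
        Matrix.add_apply, Matrix.mul_apply, Matrix.mul_apply, ← Finset.sum_add_distrib]
      refine Finset.sum_congr rfl fun a _ => ?_
      rw [fderiv_fun_mul (hl a) (hF a), ← hp w hw, ← ih]
      simp only [add_apply, smul_apply, smul_eq_mul]
      ring
    rw [h1]
    refine congrFun (congrFun ?_ i) j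
    simp only [fundamental, Nat.cast_add, Nat.cast_one, ← add_assoc, mul_sub, sub_mul,
      ← Matrix.mul_assoc]
    abel

theorem fderiv_trace_monodromy (L : LaxRepresentation K U r) (hU : IsOpen U) {z : ℂ}
    (hz : ∀ n i j, ContDiffOn ℂ ∞ (fun w => L.l n w z i j) U)
    (hp : ∀ w ∈ U, ∀ n i j, fderiv ℂ (fun v => L.l n v z i j) w (K.field w)
      = (L.p (n + 1) w z * L.l n w z - L.l n w z * L.p n w z) i j)
    {w : Config N m} (hw : w ∈ U) (n : ZMod N) :
    fderiv ℂ (fun v => (L.monodromy n v z).trace) w (K.field w) = 0 := by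
  have h1 : fderiv ℂ (fun v => (L.monodromy n v z).trace) w (K.field w)
      = (L.p n w z * L.monodromy n w z - L.monodromy n w z * L.p n w z).trace := by
    simp only [Matrix.trace, Matrix.diag, monodromy]
    rw [fderiv_fun_sum fun i _ =>
      ((L.contDiffOn_fundamental hz n N i i).contDiffAt (hU.mem_nhds hw)).differentiableAt (by simp),
      sum_apply]
    refine Finset.sum_congr rfl fun i _ => ?_
    rw [L.fderiv_fundamental hU hz hp hw]
    simp
  rw [h1, Matrix.trace_sub, Matrix.trace_mul_comm, sub_self]

end LaxRepresentation

/-! ### Gradients of conserved functionals. -/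

/-- The tangent vector at the site `n` in the coordinate `i`. -/
def siteVector {N m : ℕ} (n : ZMod N) (i : Fin m) : Config N m :=
  Pi.single n (Pi.single i 1)

/-- The gradient of the functional `g`, a covector field on the periodic manifold. -/
noncomputable def siteGradient {N m : ℕ} [NeZero N] (g : Config N m → ℂ) (w : Config N m) :
    Config N m :=
  fun n i => fderiv ℂ g w (siteVector n i)

namespace LocalSystem

variable {N m : ℕ} [NeZero N] {K : LocalSystem N m} {U : Set (Config N m)}

/-- `stencil` as a continuous linear map. -/
noncomputable def stencilL (K : LocalSystem N m) (n : ZMod N) :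
    Config N m →L[ℂ] (K.J → Fin m → ℂ) :=
  ContinuousLinearMap.pi fun j => ContinuousLinearMap.proj (n + ((j : ℤ) : ZMod N))

theorem SmoothOn.hasFDerivAt (hK : K.SmoothOn U) {w : Config N m} (hw : w ∈ U) :
    HasFDerivAt K.field (ContinuousLinearMap.pi fun n =>
      (fderiv ℂ (K.kernel n) (K.stencil w n)).comp (K.stencilL n)) w := by
  refine hasFDerivAt_pi.2 fun n => ?_
  exact HasFDerivAt.comp w (((hK w hw n).differentiableAt (by simp)).hasFDerivAt)
    (K.stencilL n).hasFDerivAt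

/-- The variable at the site `n` fills position `j` of the stencil of `K_l` exactly when `l = n -
j`. Offsets may coincide modulo `N`, hence the sum over positions. -/
theorem SmoothOn.fderiv_field_siteVector (hK : K.SmoothOn U) {w : Config N m} (hw : w ∈ U)
    (n : ZMod N) (i : Fin m) :
    fderiv ℂ K.field w (siteVector n i) = ∑ j : K.J, ∑ k : Fin m,
      K.jac w (n - ((j : ℤ) : ZMod N)) j k i • siteVector (n - ((j : ℤ) : ZMod N)) k := by
  rw [(hK.hasFDerivAt hw).fderiv]
  funext l k'
  have hst : K.stencilL l (siteVector n i)
      = ∑ j : K.J, if l = n - ((j : ℤ) : ZMod N) then Pi.single j (Pi.single i (1 : ℂ)) else 0 := by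
    funext j
    rw [Finset.sum_apply, Finset.sum_eq_single j]
    · by_cases h : l = n - ((j : ℤ) : ZMod N)
      · simp [stencilL, siteVector, h]
      · have h' : l + ((j : ℤ) : ZMod N) ≠ n := fun h' => h (eq_sub_of_add_eq h')
        simp [stencilL, siteVector, h, Pi.single_eq_of_ne h']
    · intro a _ ha
      split_ifs
      · exact Pi.single_eq_of_ne ha.symm _
      · rfl
    · simp
  simp only [ContinuousLinearMap.pi_apply, ContinuousLinearMap.comp_apply, hst, map_sum,
    Finset.sum_apply, Pi.smul_apply, smul_eq_mul]
  refine Finset.sum_congr rfl fun j _ => ?_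
  split_ifs with h
  · subst h
    rw [Finset.sum_eq_single k']
    · simp [siteVector, jac]
    · intro b _ hb
      simp [siteVector, Pi.single_eq_of_ne hb.symm]
    · simp
  · simp [siteVector, Pi.single_eq_of_ne h]

/-- The gradient of a conserved functional solves the Lax equation. -/
theorem SmoothOn.fderiv_gradient_add_adjoint (hU : IsOpen U) (hK : K.SmoothOn U)
    {g : Config N m → ℂ} (hg : ContDiffOn ℂ ∞ g U)
    (h0 : ∀ w ∈ U, fderiv ℂ g w (K.field w) = 0) {w : Config N m} (hw : w ∈ U) (n : ℤ) :
    fderiv ℂ (siteGradient g) w (K.field w) (n : ZMod N)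
      + K.adjoint w (fun l : ℤ => siteGradient g w (l : ZMod N)) n = 0 := by
  have hgw : ContDiffAt ℂ ∞ g w := hg.contDiffAt (hU.mem_nhds hw)
  have hd : DifferentiableAt ℂ (fderiv ℂ g) w :=
    (hgw.fderiv_right (m := ∞) (by simp)).differentiableAt (by simp)
  have hKd := hK.hasFDerivAt hw
  funext i
  -- The identity `dg(K) = 0` differentiated in the direction of one coordinate. By symmetry of the
  -- second derivative the first term becomes the derivative of the gradient along `K`; the second
  -- is `K'^*` applied to the gradient.
  have h1 : fderiv ℂ (fderiv ℂ g) w (siteVector (n : ZMod N) i) (K.field w)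
      + fderiv ℂ g w (fderiv ℂ K.field w (siteVector (n : ZMod N) i)) = 0 := by
    have h2 : (fun w => fderiv ℂ g w (K.field w)) =ᶠ[𝓝 w] fun _ => 0 :=
      Filter.mem_of_superset (hU.mem_nhds hw) h0
    have h3 := h2.fderiv_eq (𝕜 := ℂ)
    rw [fderiv_clm_apply hd hKd.differentiableAt] at h3
    have h4 := DFunLike.congr_fun h3 (siteVector (n : ZMod N) i)
    simp at h4
    linear_combination h4
  have hsym := (hgw.isSymmSndFDerivAt
    (by rw [minSmoothness_of_isRCLikeNormedField]; exact WithTop.coe_le_coe.2 (le_top (a := (2 : ℕ∞))))) (siteVector (n : ZMod N) i) (K.field w)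
  have h5 : fderiv ℂ (siteGradient g) w (K.field w) (n : ZMod N) i
      = fderiv ℂ (fderiv ℂ g) w (K.field w) (siteVector (n : ZMod N) i) := by
    have : HasFDerivAt (siteGradient g) (ContinuousLinearMap.pi fun n => ContinuousLinearMap.pi fun i =>
        (ContinuousLinearMap.apply ℂ ℂ (siteVector n i)).comp (fderiv ℂ (fderiv ℂ g) w)) w :=
      hasFDerivAt_pi.2 fun n => hasFDerivAt_pi.2 fun i =>
        (ContinuousLinearMap.apply ℂ ℂ (siteVector n i)).hasFDerivAt.comp w hd.hasFDerivAt
    rw [this.fderiv]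
    rfl
  rw [Pi.add_apply, h5, ← hsym, Pi.zero_apply, ← h1, hK.fderiv_field_siteVector hw]
  congr 1
  simp [adjoint, siteGradient, map_sum]

end LocalSystem

theorem contDiffOn_gradient {N m : ℕ} [NeZero N] {U : Set (Config N m)} (hU : IsOpen U)
    {g : Config N m → ℂ} (hg : ContDiffOn ℂ ∞ g U) : ContDiffOn ℂ ∞ (siteGradient g) U :=
  contDiffOn_pi.2 fun _ => contDiffOn_pi.2 fun _ => contDiffOn_fderiv_apply hU hg _

/-! ### The dispersion function. -/

/-- A differentiable logarithm of a nonvanishing function on an open interval. -/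
theorem exists_differentiable_log {I : Set ℝ} (hI : IsOpen I) (hIc : I.OrdConnected)
    {f f' : ℝ → ℂ} (hf : ∀ t ∈ I, HasDerivAt f (f' t) t) (hf' : ContinuousOn f' I)
    (h0 : ∀ t ∈ I, f t ≠ 0) :
    ∃ β : ℝ → ℂ, ∀ t ∈ I, Complex.exp (β t) = f t ∧ DifferentiableAt ℝ β t := by
  rcases I.eq_empty_or_nonempty with rfl | ⟨a, ha⟩
  · exact ⟨0, by simp⟩
  have hfc : ContinuousOn f I := fun t ht => (hf t ht).continuousAt.continuousWithinAt
  have hq : ContinuousOn (fun t => f' t / f t) I := hf'.div hfc h0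
  -- A primitive of `f' / f`, normalized at `a`; then `e^{-β} f` has zero derivative and equals `1`
  -- at `a`.
  set β : ℝ → ℂ := fun t => Complex.log (f a) + ∫ s in a..t, f' s / f s with hβ
  have hβd : ∀ t ∈ I, HasDerivAt β (f' t / f t) t := fun t ht =>
    (intervalIntegral.integral_hasDerivAt_right
      ((hq.mono (hIc.uIcc_subset ha ht)).intervalIntegrable)
      (hq.stronglyMeasurableAtFilter hI t ht) (hq.continuousAt (hI.mem_nhds ht))).const_add _
  refine ⟨β, fun t ht => ⟨?_, (hβd t ht).differentiableAt⟩⟩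
  have hd : ∀ t ∈ I, HasDerivAt (fun t => Complex.exp (-β t) * f t) 0 t := fun t ht => by
    have := (hβd t ht).fun_neg.cexp.fun_mul (hf t ht)
    convert! this using 1
    have := h0 t ht
    field_simp
    ring
  have hc := hI.is_const_of_deriv_eq_zero hIc.isPreconnected
    (fun t ht => (hd t ht).differentiableAt.differentiableWithinAt)
    (fun t ht => (hd t ht).deriv) ht ha
  have ha1 : Complex.exp (-β a) * f a = 1 := by
    simp [hβ, Complex.exp_neg, Complex.exp_log (h0 a ha), h0 a ha]
  rw [ha1, Complex.exp_neg, inv_mul_eq_one₀ (Complex.exp_ne_zero _)] at hc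
  exact hc

namespace LocalSystem

variable {N m : ℕ} [NeZero N] {U : Set (Config N m)} {K : LocalSystem N m}

/-- A dispersion function along a trajectory: a logarithm of a functional whose expansion has a
nonvanishing leading coefficient. -/
theorem IsTrajectory.exists_dispersion (hU : IsOpen U) (hK : K.SmoothOn U) {f : Config N m → ℂ → ℂ} {e : ℤ}
    {b : ℕ → Config N m → ℂ} (hb : ContDiffOn ℂ ∞ (b 0) U) (hf : HasExpansion U f e b)
    (hb0 : ∀ w ∈ U, b 0 w ≠ 0)
    (hfs : ∀ w₀ ∈ U, ∀ᶠ p in 𝓝 w₀ ×ˢ Bornology.cobounded ℂ,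
      DifferentiableAt ℂ (fun w => f w p.2) p.1)
    {I : Set ℝ} {w : ℝ → Config N m} (hw : K.IsTrajectory U I w) :
    ∃ om : ℝ → ℂ → ℂ, ∀ t₀ ∈ I, ∀ᶠ p in 𝓝 t₀ ×ˢ Bornology.cobounded ℂ,
      DifferentiableAt ℝ (fun t => om t p.2) p.1 ∧ Complex.exp (om p.1 p.2) = f (w p.1) p.2 := by
  have hbd : ∀ t ∈ I, DifferentiableAt ℂ (b 0) (w t) := fun t ht =>
    (hb.contDiffAt (hU.mem_nhds (hw.mem t ht))).differentiableAt (by simp)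
  have hwc : ContinuousOn w I := fun t ht => (hw.hasDerivAt t ht).continuousAt.continuousWithinAt
  have hKc : ContinuousOn K.field U := fun w hw =>
    (hK.hasFDerivAt hw).continuousAt.continuousWithinAt
  obtain ⟨β, hβ⟩ := exists_differentiable_log hw.isOpen hw.ordConnected
    (fun t ht => hw.differentiableAt_comp ht (hbd t ht))
    (((hb.continuousOn_fderiv_of_isOpen hU (by simp)).clm_apply hKc).comp hwc hw.mem)
    fun t ht => hb0 _ (hw.mem t ht)
  -- One `om` must serve the whole interval. The functional is split into `z^e`, its leading
  -- coefficient, which has a global logarithm `β` along the trajectory, and a factor tending to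
  -- `1`, for which the principal branch is differentiable.
  refine ⟨fun t z => Complex.log (z ^ e) + β t + Complex.log (z ^ (-e) * f (w t) z / b 0 (w t)),
    fun t₀ ht₀ => ?_⟩
  have hT := hw.tendsto_prod ht₀ (Bornology.cobounded ℂ)
  have hwU := hw.mem t₀ ht₀
  filter_upwards [hT.eventually (((hf.tendsto_normalized hU hb hwU (hb0 _ hwU)).eventually
      (Complex.isOpen_slitPlane.mem_nhds Complex.one_mem_slitPlane)).and (hfs _ hwU)),
    tendsto_fst.eventually (hw.isOpen.mem_nhds ht₀), eventually_snd_ne_zero (𝓝 t₀)]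
    with p hp hpI hz
  have hbp := hb0 _ (hw.mem p.1 hpI)
  have hze := zpow_ne_zero e hz
  constructor
  · refine ((hβ p.1 hpI).2.const_add _).fun_add (HasDerivAt.clog_real
      (((hw.differentiableAt_comp hpI hp.2).differentiableAt.const_mul _).fun_div
        (hw.differentiableAt_comp hpI (hbd p.1 hpI)).differentiableAt hbp).hasDerivAt
          hp.1).differentiableAt
  · rw [Complex.exp_add, Complex.exp_add, Complex.exp_log hze, (hβ p.1 hpI).1,
      Complex.exp_log (Complex.slitPlane_ne_zero hp.1), zpow_neg]
    field_simp

end LocalSystem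

/-! ### From a covector field to the data of the ansatz. -/

namespace LaxAnsatz

variable {N m : ℕ} [NeZero N] [NeZero m] {U : Set (Config N m)} {K : LocalSystem N m}

/-- A covector field with expansions, whose first component is of the same exact order at all
sites, determines the data of an ansatz. -/
theorem exists_of_covectorField (hU : IsOpen U) {φ : Config N m → ℂ → Config N m} {d e : ℤ}
    {c : ℕ → ZMod N → Fin m → Config N m → ℂ} {b : ℕ → ZMod N → Config N m → ℂ}
    (hφ : ∀ w₀ ∈ U, ∀ᶠ p in 𝓝 w₀ ×ˢ Bornology.cobounded ℂ, ContDiffAt ℂ ∞ (fun w => φ w p.2) p.1)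
    (hc : ∀ s n i, ContDiffOn ℂ ∞ (c s n i) U) (hb : ∀ s n, ContDiffOn ℂ ∞ (b s n) U)
    (hφc : ∀ n i, HasExpansion U (fun w z => φ w z n i) d (fun s => c s n i))
    (hφb : ∀ n, HasExpansion U (fun w z => φ w z n 0) e (fun s => b s n))
    (hb0 : ∀ n, ∀ w ∈ U, b 0 n w ≠ 0) :
    ∃ A : LaxAnsatz U,
      (∀ n w z i, A.a n w z i = if i = 0 then 1 else φ w z n i / φ w z n 0) ∧
      ∀ n w z, A.σ n w z = φ w z n 0 / φ w z (n - 1) 0 := by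
  choose a ha _ hae using fun n i => (hφc n i).div hU (hφb n) (fun s => hc s n i)
    (fun s => hb s n) (hb0 n)
  choose q hq hq0 hqe using fun n => (hφb n).div hU (hφb (n - 1)) (fun s => hb s n)
    (fun s => hb s (n - 1)) (hb0 (n - 1))
  have hev : ∀ w₀ ∈ U, ∀ᶠ p in 𝓝 w₀ ×ˢ Bornology.cobounded ℂ, ∀ n i,
      φ p.1 p.2 n 0 ≠ 0 ∧ ContDiffAt ℂ ∞ (fun w => φ w p.2 n i) p.1 := fun w₀ hw => by
    filter_upwards [hφ w₀ hw, eventually_all.2 fun n =>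
      (hφb n).eventually_ne_zero hU (hb 0 n) hw (hb0 n w₀ hw)] with p h1 h2 n i
    exact ⟨h2 n, contDiffAt_pi.1 (contDiffAt_pi.1 h1 n) i⟩
  refine ⟨{ a := fun n w z i => if i = 0 then 1 else φ w z n i / φ w z n 0
            σ := fun n w z => φ w z n 0 / φ w z (n - 1) 0
            aOrder := d - e
            -- That is, `0`: the first components at neighbouring sites have the same exact order.
            sOrder := e - e
            aCoeff := fun s n i => a n i s
            sCoeff := fun s n => q n s
            a_first := fun n w z => if_pos rfl
            a_smooth := fun w₀ hw => (hev w₀ hw).mono fun p hp n => contDiffAt_pi.2 fun i => ?_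
            s_smooth := fun w₀ hw => (hev w₀ hw).mono fun p hp n =>
              (hp n 0).2.fun_div (hp (n - 1) 0).2 (hp (n - 1) 0).1
            aCoeff_smooth := fun s n i => ha n i s
            sCoeff_smooth := fun s n => hq n s
            a_expansion := fun n i hi => by simpa only [if_neg hi] using hae n i
            s_expansion := hqe
            sCoeff_zero_ne := fun n w hw => by
              rw [hq0]
              exact div_ne_zero (hb0 n w hw) (hb0 (n - 1) w hw) }, fun _ _ _ _ => rfl,
            fun _ _ _ => rfl⟩
  by_cases hi : i = 0
  · simpa only [if_pos hi] using contDiffAt_const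
  · simpa only [if_neg hi] using (hp n i).2.fun_div (hp n 0).2 (hp n 0).1

/-- The product of the ratios `φ_j / φ_{j-1}` of first components telescopes to `φ_n / φ_{-1}`, and
`e^om` supplies `φ_{-1}`. -/
theorem covector_eq {A : LaxAnsatz U} {φ : Config N m → ℂ → Config N m}
    (ha : ∀ n w z i, A.a n w z i = if i = 0 then 1 else φ w z n i / φ w z n 0)
    (hσ : ∀ n w z, A.σ n w z = φ w z n 0 / φ w z (n - 1) 0) {w : ℝ → Config N m}
    {om : ℝ → ℂ → ℂ} {t : ℝ} {z : ℂ} (h0 : ∀ n, φ (w t) z n 0 ≠ 0)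
    (hom : Complex.exp (om t z) = φ (w t) z (-1) 0) (n : ℤ) :
    A.covector w om t z n = φ (w t) z (n : ZMod N) := by
  have h1 := eq_siteProd_mul (f := fun j : ℤ => A.σ (j : ZMod N) (w t) z)
    (P := fun j : ℤ => φ (w t) z (j : ZMod N) 0)
    (fun j => by simpa only [hσ] using div_ne_zero (h0 _) (h0 _)) (fun j => by
      rw [hσ]
      push_cast
      rw [add_sub_cancel_right, mul_div_cancel₀ _ (h0 _)]) n
  funext i
  simp only [Int.cast_neg, Int.cast_one] at h1
  rw [covector, ha, hom, mul_assoc, mul_comm (φ (w t) z (-1) 0), ← h1]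
  split_ifs with hi
  · rw [hi, one_mul]
  · rw [div_mul_cancel₀ _ (h0 _)]

/-- The residual is identically zero for large `z`, not merely small. -/
theorem solvesAsymptotically_of_isLaxSolution {A : LaxAnsatz U}
    {φ : Config N m → ℂ → Config N m} (hφ : K.IsLaxSolution U φ) {I : Set ℝ}
    {w : ℝ → Config N m} (hw : K.IsTrajectory U I w) {om : ℝ → ℂ → ℂ}
    (hom : ∀ t₀ ∈ I, ∀ᶠ p in 𝓝 t₀ ×ˢ Bornology.cobounded ℂ,
      DifferentiableAt ℝ (fun t => om t p.2) p.1)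
    (h : ∀ t₀ ∈ I, ∀ᶠ p in 𝓝 t₀ ×ˢ Bornology.cobounded ℂ,
      ∀ n : ℤ, φ (w p.1) p.2 (n : ZMod N) = A.covector w om p.1 p.2 n) :
    A.SolvesAsymptotically K I w om := by
  intro t₀ ht₀
  refine ⟨hom t₀ ht₀, fun n i k => ?_⟩
  refine (isBigO_zero _ _).congr' ?_ EventuallyEq.rfl
  filter_upwards [eventually_prod_nhds (h t₀ ht₀),
    (hw.tendsto_prod ht₀ _).eventually (hφ _ (hw.mem t₀ ht₀)),
    tendsto_fst.eventually (hw.isOpen.mem_nhds ht₀)] with p hp hL hpI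
  have h1 : (fun t => A.covector w om t p.2 n i) =ᶠ[𝓝 p.1] fun t => φ (w t) p.2 (n : ZMod N) i :=
    hp.mono fun t ht => (congrFun (ht n) i).symm
  have h2 : A.covector w om p.1 p.2 = fun l : ℤ => φ (w p.1) p.2 (l : ZMod N) :=
    funext fun l => (hp.self_of_nhds l).symm
  have h3 := hw.differentiableAt_comp hpI (hL.1.differentiableAt (by simp))
  have h4 := hasDerivAt_pi.1 (hasDerivAt_pi.1 h3 (n : ZMod N)) i
  have h5 := congrFun (hL.2 n) i
  rw [h1.deriv_eq, h4.deriv, h2]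
  simp only [Pi.add_apply, Pi.zero_apply] at h5
  rw [h5, zero_div]

end LaxAnsatz

/-! ### The proposition. -/

theorem mainTheorem2 {N m r : ℕ} [NeZero N] [NeZero m]
    (K : LocalSystem N m) (U : Set (Config N m)) (hU : IsOpen U) (hK : K.SmoothOn U)
    (L : LaxRepresentation K U r)
    (j₀ : ℕ) (γbar : ℕ → Config N m → ℂ) (hγsmooth : ∀ j, ContDiffOn ℂ ∞ (γbar j) U)
    (hγ : HasExpansion U (fun w z => (L.monodromy 0 w z).trace) (j₀ : ℤ) γbar)
    (q : ℕ)
    (hq : ∀ w ∈ U, ∀ n : ZMod N,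
      (∀ j < q, gradFirst (γbar j) w n = 0) ∧ gradFirst (γbar q) w n ≠ 0) :
    (∃ (A : LaxAnsatz U) (φ : Config N m → ℂ → Config N m),
      K.IsLaxSolution U φ ∧
      ∀ (I : Set ℝ) (w : ℝ → Config N m), K.IsTrajectory U I w →
        ∃ om : ℝ → ℂ → ℂ, A.SolvesAsymptotically K I w om ∧
          ∀ t₀ ∈ I, ∀ᶠ p in 𝓝 t₀ ×ˢ Bornology.cobounded ℂ,
            ∀ n : ℤ, φ (w p.1) p.2 (n : ZMod N) = A.covector w om p.1 p.2 n) ∧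
    (∀ A : LaxAnsatz U,
      (∀ (I : Set ℝ) (w : ℝ → Config N m), K.IsTrajectory U I w →
        ∃ om : ℝ → ℂ → ℂ, A.SolvesAsymptotically K I w om) →
      A.GeneratesConservationLaws K) := by
  refine ⟨?_, fun A hA => A.generatesConservationLaws hU hA⟩
  set φ : Config N m → ℂ → Config N m :=
    fun w z => siteGradient (fun v => (L.monodromy 0 v z).trace) w with hφ
  have hsm : ∀ᶠ z in Bornology.cobounded ℂ,
      ContDiffOn ℂ ∞ (fun w => (L.monodromy 0 w z).trace) U :=
    L.smooth.mono fun z hz => L.contDiffOn_trace_monodromy hz 0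
  have hin : ∀ w₀ ∈ U, ∀ᶠ p in 𝓝 w₀ ×ˢ Bornology.cobounded ℂ, p.1 ∈ U := fun w₀ hw =>
    tendsto_fst.eventually (hU.mem_nhds hw)
  have hLax : K.IsLaxSolution U φ := by
    intro w₀ hw
    filter_upwards [hin w₀ hw, tendsto_snd.eventually L.smooth, tendsto_snd.eventually L.compat]
      with p hpU hs hc
    have hg := L.contDiffOn_trace_monodromy hs 0
    exact ⟨(contDiffOn_gradient hU hg).contDiffAt (hU.mem_nhds hpU), fun n =>
      hK.fderiv_gradient_add_adjoint hU hg (fun w hw => L.fderiv_trace_monodromy hU hs hc hw 0)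
        hpU n⟩
  have hφs : ∀ w₀ ∈ U, ∀ᶠ p in 𝓝 w₀ ×ˢ Bornology.cobounded ℂ,
      ContDiffAt ℂ ∞ (fun w => φ w p.2) p.1 := fun w₀ hw => (hLax w₀ hw).mono fun p hp => hp.1
  have hφc : ∀ n i, HasExpansion U (fun w z => φ w z n i) j₀
      (fun s w => fderiv ℂ (γbar s) w (siteVector n i)) := fun n i =>
    hγ.fderiv_apply hU (hsm.mono fun z hz => hz.differentiableOn (by simp)) hγsmooth _
  -- The order `j₀` bounds all components, but only after the `q` vanishing terms are dropped is the
  -- leading coefficient of the first component nonzero, so that one may divide by it.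
  have hφb : ∀ n, HasExpansion U (fun w z => φ w z n 0) (j₀ - q)
      (fun s w => gradFirst (γbar (s + q)) w n) := fun n =>
    (hφc n 0).shift hU fun w hw j hj => (hq w hw n).1 j hj
  have hbs : ∀ s n, ContDiffOn ℂ ∞ (fun w => gradFirst (γbar (s + q)) w n) U := fun s n =>
    contDiffOn_fderiv_apply hU (hγsmooth _) _
  have hb0 : ∀ n, ∀ w ∈ U, gradFirst (γbar (0 + q)) w n ≠ 0 := fun n w hw => by
    rw [zero_add]
    exact (hq w hw n).2
  obtain ⟨A, ha, hσ⟩ := LaxAnsatz.exists_of_covectorField hU hφs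
    (c := fun s n i w => fderiv ℂ (γbar s) w (siteVector n i))
    (b := fun s n w => gradFirst (γbar (s + q)) w n)
    (fun s n i => contDiffOn_fderiv_apply hU (hγsmooth s) _) hbs hφc hφb hb0
  refine ⟨A, φ, hLax, fun I w hw => ?_⟩
  -- The site `-1` is where the product over sites is empty, so `e^om` has to be the first component
  -- of `φ` there.
  obtain ⟨om, hom⟩ := hw.exists_dispersion hU hK (hbs 0 (-1)) (hφb (-1)) (hb0 (-1))
    (fun w₀ hw => (hφs w₀ hw).mono fun p hp =>
      (contDiffAt_pi.1 (contDiffAt_pi.1 hp (-1)) 0).differentiableAt (by simp))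
  have heq : ∀ t₀ ∈ I, ∀ᶠ p in 𝓝 t₀ ×ˢ Bornology.cobounded ℂ,
      ∀ n : ℤ, φ (w p.1) p.2 (n : ZMod N) = A.covector w om p.1 p.2 n := fun t₀ ht₀ => by
    have hne : ∀ᶠ p in 𝓝 (w t₀) ×ˢ Bornology.cobounded ℂ, ∀ n, φ p.1 p.2 n 0 ≠ 0 :=
      eventually_all.2 fun n => (hφb n).eventually_ne_zero hU (hbs 0 n) (hw.mem t₀ ht₀)
        (hb0 n _ (hw.mem t₀ ht₀))
    filter_upwards [(hw.tendsto_prod ht₀ _).eventually hne, hom t₀ ht₀] with p hp hpo n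
    exact (LaxAnsatz.covector_eq ha hσ hp hpo.2 n).symm
  exact ⟨om, LaxAnsatz.solvesAsymptotically_of_isLaxSolution hLax hw
    (fun t₀ ht₀ => (hom t₀ ht₀).mono fun p hp => hp.1) heq, heq⟩
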